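/- A divisible design graph (DDG) with parameters $(v,k,\lambda_1,\lambda_2,m,n)$ is a $k$-regular graph on $v$ vertices whose vertex set can be partitioned into $m$ classes of size $n$ (a canonical partition) such that two distinct vertices of the same class have exactly $\lambda_1$ common neighbours and two vertices of different classes have exactly $\lambda_2$ common neighbours. A partition $V_1,\dots,V_m$ of the vertices is equitable with quotient matrix $R=(r_{ij})$ if every vertex of $V_i$ has exactly $r_{ij}$ neighbours in $V_j$, for all $i,j$. The $4\times n$-lattice graph is the line graph of $K_{4,n}$; equivalently its vertices are the cells of a $4\times n$ board, two distinct cells being adjacent if they share a row or a column. Put $$M_1=\begin{pmatrix} n-1&1&1&1\\1&n-1&1&1\\1&1&n-1&1\\1&1&1&n-1\end{pmatrix},\quad M_2=\begin{pmatrix} 1&n-1&1&1\\n-1&1&1&1\\1&1&n-1&1\\1&1&1&n-1\end{pmatrix},\quad M_3=\begin{pmatrix} 1&n-1&1&1\\n-1&1&1&1\\1&1&1&n-1\\1&1&n-1&1\end{pmatrix}.$$ The graph $G'(n)$ ($n$ even) is obtained from the $4\times n$-lattice graph by generalised dual Seidel switching: let $H$ be the subgraph induced on the first two rows and $\varphi$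 the central symmetry of the $2\times n$ board formed by these rows; in $G'(n)$ two cells $x,y$ of $H$ are adjacent if and only if $\varphi(x)$ and $y$ are adjacent in $H$, and all adjacencies involving a cell outside $H$ are unchanged. Reverse switching: take a disjoint union of finitely many graphs, each with its vertices distributed over four classes $V_1,\dots,V_4$, and each of one of the following two kinds. (i) The graph $C_s[\overline{K_2}]$ with $s=4r$, $r\ge 1$ (the vertices are the pairs $(p,b)$ with $p\in\mathbb Z/s$, $b\in\{0,1\}$; $(p,b)$ and $(p',b')$ are adjacent if and only if $p'=p\pm1$). For some permutation $\tau$ of $\{1,2,3,4\}$, the vertices $(p,0)$ and $(p,1)$ belong to $V_{\tau(1)}$ and $V_{\tau(2)}$ respectively if $p\equiv 0,1 \pmod 4$, and to $V_{\tau(3)}$ and $V_{\tau(4)}$ respectively if $p\equiv 2,3\pmod 4$. (ii) The 4-cube (binary words of length 4, adjacent if they differ in exactly one position), with any admissible equitable partition into four labelled classes: its quotient matrix is the all-ones matrix $J_4$, and edges lying inside different classes have different directions (the direction of an edge is the position in which its ends differ). In this disjoint union reverse all adjacencies (edges become non-edges and vice versa) between $V_1$ and $V_2$ and all adjacencies between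 $V_3$ and $V_4$. The resulting graph is said to be obtained by reverse switching. **Theorem.** Let $n\ge 2$, $n\neq 4$ (so that the parameters below are those of a proper DDG), and let $G$ be a DDG with parameters $(4n,n+2,n-2,2,4,n)$. 1. If $n$ is odd, then $G$ is isomorphic to the $4\times n$-lattice graph. 2. If $n$ is even, then, for a suitable ordering of its classes, the canonical partition of $G$ is equitable with quotient matrix $M_1$, $M_2$ or $M_3$. Moreover, if for some ordering of the classes the quotient matrix is (a) $M_1$, then $G$ is isomorphic to the $4\times n$-lattice graph; (b) $M_2$, then $G$ is isomorphic to $G'(n)$; (c) $M_3$, then $G$ is isomorphic to a graph obtained by reverse switching. -/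

import Mathlib

namespace LatticeDDG

/-- `G` is a divisible design graph with parameters `(v, k, l1, l2, m, n)`, where `cls` numbers the
`m` classes of a canonical partition by `Fin m`. -/
structure IsDDG {V : Type*} (G : SimpleGraph V) (v k l1 l2 m n : ℕ) (cls : V → Fin m) : Prop where
  card_vertices : Nat.card V = v
  regular : ∀ x, (G.neighborSet x).ncard = k
  card_class : ∀ i, {x | cls x = i}.ncard = n
  same_class : ∀ x y, x ≠ y → cls x = cls y → (G.commonNeighbors x y).ncard = l1
  diff_class : ∀ x y, cls x ≠ cls y → (G.commonNeighbors x y).ncard = l2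

/-- The partition of the vertices into the fibres of `cls` is equitable with quotient matrix `R`:
every vertex of the `i`-th class has exactly `R i j` neighbours in the `j`-th class. -/
def IsQuotientMatrix {V : Type*} (G : SimpleGraph V) {m : ℕ} (cls : V → Fin m)
    (R : Matrix (Fin m) (Fin m) ℕ) : Prop :=
  ∀ x j, {y | G.Adj x y ∧ cls y = j}.ncard = R (cls x) j

/-- The first of the three possible quotient matrices. -/
def matrix1 (n : ℕ) : Matrix (Fin 4) (Fin 4) ℕ :=
  !![n - 1, 1, 1, 1;
     1, n - 1, 1, 1;
     1, 1, n - 1, 1;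
     1, 1, 1, n - 1]

/-- The second of the three possible quotient matrices. -/
def matrix2 (n : ℕ) : Matrix (Fin 4) (Fin 4) ℕ :=
  !![1, n - 1, 1, 1;
     n - 1, 1, 1, 1;
     1, 1, n - 1, 1;
     1, 1, 1, n - 1]

/-- The third of the three possible quotient matrices. -/
def matrix3 (n : ℕ) : Matrix (Fin 4) (Fin 4) ℕ :=
  !![1, n - 1, 1, 1;
     n - 1, 1, 1, 1;
     1, 1, 1, n - 1;
     1, 1, n - 1, 1]

/-! ### Lattice graphs and generalised dual Seidel switching -/

/-- The `m × n`-lattice graph: the line graph of the complete bipartite graph `K_{m,n}`. -/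
abbrev latticeGraph (m n : ℕ) :=
  (completeBipartiteGraph (Fin m) (Fin n)).lineGraph

/-- The `m × n`-lattice graph in coordinates: distinct cells of an `m × n` board are adjacent when
they share a row or a column. -/
def gridGraph (m n : ℕ) : SimpleGraph (Fin m × Fin n) where
  Adj x y := x ≠ y ∧ (x.1 = y.1 ∨ x.2 = y.2)
  symm := ⟨fun _ _ h => ⟨h.1.symm, h.2.imp Eq.symm Eq.symm⟩⟩
  loopless := ⟨fun _ h => h.1 rfl⟩

/-- The two descriptions of the lattice graph agree. -/
theorem nonempty_gridGraph_iso (m n : ℕ) : Nonempty (gridGraph m n ≃g latticeGraph m n) := by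
  let f : Fin m × Fin n → (completeBipartiteGraph (Fin m) (Fin n)).edgeSet := fun x =>
    ⟨s(Sum.inl x.1, Sum.inr x.2), by simp⟩
  have hf : Function.Bijective f := by
    constructor
    · rintro ⟨i, j⟩ ⟨i', j'⟩ h
      simpa [f] using h
    · rintro ⟨e, he⟩
      induction e using Sym2.ind with
      | _ a b =>
        rcases a with a | a <;> rcases b with b | b <;> simp at he
        · exact ⟨(a, b), rfl⟩
        · exact ⟨(b, a), Subtype.ext Sym2.eq_swap⟩
  refine ⟨⟨Equiv.ofBijective f hf, ?_⟩⟩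
  rintro ⟨i, j⟩ ⟨i', j'⟩
  have hne : f (i, j) ≠ f (i', j') ↔ (i, j) ≠ (i', j') := hf.1.ne_iff
  show (f (i, j) ≠ f (i', j') ∧ _) ↔ _
  rw [hne]
  simp [gridGraph, f, Set.Nonempty, or_and_right, exists_or]

/-- `φ` restricts to a Seidel automorphism of the subgraph of `G` induced on `S`: an involutive
automorphism that interchanges only non-adjacent vertices. -/
structure IsSeidelAut {V : Type*} (G : SimpleGraph V) (S : Set V) (φ : V → V) : Prop where
  maps : ∀ x ∈ S, φ x ∈ S
  invol : ∀ x ∈ S, φ (φ x) = x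
  adj_iff : ∀ x ∈ S, ∀ y ∈ S, (G.Adj (φ x) (φ y) ↔ G.Adj x y)
  not_adj : ∀ x ∈ S, ¬ G.Adj x (φ x)

/-- Generalised dual Seidel switching: the rows of the adjacency matrix of the subgraph induced on
`S` are permuted by `φ`, and all adjacencies that involve a vertex outside `S` are kept. -/
def gdss {V : Type*} (G : SimpleGraph V) (S : Set V) (φ : V → V) : SimpleGraph V :=
  SimpleGraph.fromRel fun x y =>
    ((x ∈ S ∧ y ∈ S) ∧ G.Adj (φ x) y) ∨ (¬ (x ∈ S ∧ y ∈ S) ∧ G.Adj x y)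

/-- When `φ` is a Seidel automorphism, the symmetrisation in `gdss` changes nothing. -/
theorem gdss_adj {V : Type*} {G : SimpleGraph V} {S : Set V} {φ : V → V}
    (h : IsSeidelAut G S φ) (x y : V) :
    (gdss G S φ).Adj x y ↔
      ((x ∈ S ∧ y ∈ S) ∧ G.Adj (φ x) y) ∨ (¬ (x ∈ S ∧ y ∈ S) ∧ G.Adj x y) := by
  have key : ∀ a ∈ S, ∀ b ∈ S, G.Adj (φ b) a → G.Adj (φ a) b := by
    intro a ha b hb hab
    have := (h.adj_iff a ha (φ b) (h.maps b hb)).2 hab.symm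
    rwa [h.invol b hb] at this
  rw [gdss, SimpleGraph.fromRel_adj]
  constructor
  · rintro ⟨-, h1 | ⟨⟨hy, hx⟩, h1⟩ | ⟨h1, h2⟩⟩
    · exact h1
    · exact Or.inl ⟨⟨hx, hy⟩, key x hx y hy h1⟩
    · exact Or.inr ⟨fun h3 => h1 h3.symm, h2.symm⟩
  · intro h1
    refine ⟨?_, Or.inl h1⟩
    rintro rfl
    rcases h1 with ⟨⟨hx, -⟩, h1⟩ | ⟨-, h1⟩
    · exact h.not_adj x hx h1.symm
    · exact G.loopless.irrefl x h1

/-- The first two rows of the `4 × n` board; they induce a `2 × n`-lattice graph. -/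
def topRows (n : ℕ) : Set (Fin 4 × Fin n) := {x | x.1 = 0 ∨ x.1 = 1}

/-- The central symmetry of the first two rows of the `4 × n` board. -/
def centralSymm (n : ℕ) (x : Fin 4 × Fin n) : Fin 4 × Fin n :=
  (Equiv.swap 0 1 x.1, x.2.rev)

theorem isSeidelAut_centralSymm {n : ℕ} (hn : Even n) :
    IsSeidelAut (gridGraph 4 n) (topRows n) (centralSymm n) where
  maps := by
    rintro ⟨i, j⟩ (h | h) <;> (simp only at h; subst h; simp [topRows, centralSymm])
  invol := by
    rintro ⟨i, j⟩ -
    simp [centralSymm]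
  adj_iff := by
    rintro ⟨i, j⟩ - ⟨i', j'⟩ -
    simp [gridGraph, centralSymm, Prod.ext_iff, Fin.rev_inj]
  not_adj := by
    obtain ⟨k, hk⟩ := hn
    rintro ⟨i, j⟩ hx ⟨-, h | h⟩
    · rcases hx with hx | hx <;> (simp only at hx; subst hx; simp [centralSymm] at h)
    · have := congrArg Fin.val h
      simp only [centralSymm, Fin.val_rev] at this
      omega

/-- The graph `G'(n)`: generalised dual Seidel switching of the `4 × n`-lattice graph with respect
to the central symmetry of a `2 × n`-sublattice. -/
def gPrime (n : ℕ) : SimpleGraph (Fin 4 × Fin n) :=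
  gdss (gridGraph 4 n) (topRows n) (centralSymm n)

/-! ### Reverse switching -/

/-- The composition (lexicographic product) `G[H]`. -/
def lexProduct {V W : Type*} (G : SimpleGraph V) (H : SimpleGraph W) : SimpleGraph (V × W) where
  Adj x y := G.Adj x.1 y.1 ∨ (x.1 = y.1 ∧ H.Adj x.2 y.2)
  symm := ⟨fun _ _ h => h.imp (fun h' => h'.symm) (fun h' => ⟨h'.1.symm, h'.2.symm⟩)⟩
  loopless := ⟨fun x h => h.elim (G.loopless.irrefl x.1) (fun h' => H.loopless.irrefl x.2 h'.2)⟩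

/-- The 4-cube: binary words of length 4, adjacent when they differ in exactly one position. -/
def fourCube : SimpleGraph (Fin 4 → Bool) where
  Adj x y := hammingDist x y = 1
  symm := ⟨fun x y h => by rw [hammingDist_comm]; exact h⟩
  loopless := ⟨fun x h => by simp at h⟩

/-- The neighbour of the word `x` along the direction `i`. -/
def flipBit (x : Fin 4 → Bool) (i : Fin 4) : Fin 4 → Bool := Function.update x i (!x i)

/-- An admissible equitable partition of the 4-cube: its quotient matrix is the all-ones matrix, and
edges lying inside different classes have different directions. -/
structure IsAdmissibleCubePartition (f : (Fin 4 → Bool) → Fin 4) : Prop where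
  equitable : IsQuotientMatrix fourCube f (fun _ _ => 1)
  directions : ∀ x y i, f x = f (flipBit x i) → f y = f (flipBit y i) → f x = f y

/-- The building blocks: a copy of `C_s[K̄₂]` with `s = 4 r`, whose partition is described in
`Piece.label` and depends on a numbering `τ` of the four classes, or a copy of the 4-cube with
an admissible equitable partition `f`. -/
inductive Piece : Type
  | cycle (r : ℕ) (hr : 0 < r) (τ : Equiv.Perm (Fin 4)) : Piece
  | cube (f : (Fin 4 → Bool) → Fin 4) (hf : IsAdmissibleCubePartition f) : Piece

/-- The vertices of a building block. -/
def Piece.Vertex : Piece → Type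
  | .cycle r _ _ => Fin (4 * r) × Fin 2
  | .cube _ _ => Fin 4 → Bool

/-- The graph of a building block: `C_{4r}[K̄₂]` or the 4-cube. -/
def Piece.graph : (P : Piece) → SimpleGraph P.Vertex
  | .cycle r _ _ => lexProduct (SimpleGraph.cycleGraph (4 * r)) (⊥ : SimpleGraph (Fin 2))
  | .cube _ _ => fourCube

/-- The class of a vertex of a building block. Around the cycle of `C_{4r}[K̄₂]`, the copies of `K̄₂`
consist, alternately for two consecutive copies each, of one vertex from each of the classes `τ 0`,
`τ 1` and of one vertex from each of the classes `τ 2`, `τ 3`. -/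
def Piece.label : (P : Piece) → P.Vertex → Fin 4
  | .cycle _ _ τ => fun x =>
      if x.1.val % 4 < 2 then (if x.2 = 0 then τ 0 else τ 1) else (if x.2 = 0 then τ 2 else τ 3)
  | .cube f _ => f

/-- The disjoint union of a family of graphs. -/
def disjointUnion {ι : Type*} {V : ι → Type*} (G : ∀ i, SimpleGraph (V i)) :
    SimpleGraph (Σ i, V i) where
  Adj x y := ∃ (i : ι) (a b : V i), x = ⟨i, a⟩ ∧ y = ⟨i, b⟩ ∧ (G i).Adj a b
  symm := ⟨fun _ _ ⟨i, a, b, hx, hy, h⟩ => ⟨i, b, a, hy, hx, h.symm⟩⟩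
  loopless := ⟨by
    rintro _ ⟨i, a, b, rfl, hy, h⟩
    obtain rfl := eq_of_heq (Sigma.mk.inj hy).2
    exact (G i).loopless.irrefl a h⟩

/-- The class that is switched against the class `i`: the classes are paired as `{0, 1}`, `{2, 3}`. -/
def mate : Fin 4 → Fin 4 := ![1, 0, 3, 2]

theorem mate_ne (i : Fin 4) : mate i ≠ i := by
  revert i; decide

theorem mate_eq_comm (i j : Fin 4) : mate i = j ↔ mate j = i := by
  revert i j; decide

/-- Reversal of all adjacencies between the classes 0 and 1 and between the classes 2 and 3. -/
def switchPairs {W : Type*} (H : SimpleGraph W) (d : W → Fin 4) : SimpleGraph W where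
  Adj x y := (mate (d x) = d y ∧ ¬ H.Adj x y) ∨ (mate (d x) ≠ d y ∧ H.Adj x y)
  symm := ⟨fun x y h => by
    rw [H.adj_comm, mate_eq_comm, Ne, mate_eq_comm (d y)]
    exact h⟩
  loopless := ⟨fun x h => h.elim (fun h' => mate_ne _ h'.1) (fun h' => H.loopless.irrefl x h'.2)⟩

/-- The graph obtained by reverse switching from the disjoint union of the building blocks
`P 0, …, P (N - 1)`, each with its partition into four classes. -/
def reverseSwitching {N : ℕ} (P : Fin N → Piece) : SimpleGraph (Σ i, (P i).Vertex) :=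
  switchPairs (disjointUnion fun i => (P i).graph) fun w => (P w.1).label w.2

end LatticeDDG

namespace LatticeDDG

open Matrix

/-! The adjacency matrix `A` satisfies `A² = 4I + (n - 4)K + 2J`, where `K` is the class matrix and
`J` the all-ones matrix. Since `A` commutes with `A²`, `I` and `J`, and `n ≠ 4`, it commutes with
`K`: the canonical partition is equitable, with a symmetric quotient matrix `R`
(`IsDDG.exists_isQuotientMatrix`). Put `N = n - 2`. The integral matrix `R - J` has entries at least
`-1`, row sums `N` and square `N² I`. Arithmetic (`quotient_cases`) shows that it is `N` times the
permutation matrix of an involution `σ` of the classes, up to one exception for `n = 5`, which a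
tournament argument excludes (`not_sporadic`). For odd `n` the diagonal of `R` is even by the
handshake lemma, so `σ` is the identity. In general `σ` has zero, one or two transpositions, which
gives the three matrices.

Now every vertex `x` has one special vertex `nb x j` in each class `j`: a unique neighbour, or a
unique non-neighbour if `j` is the image of the class of `x` under `σ`. Counting common neighbours
of vertices in different classes turns the design condition into coincidences between ends of
two-step walks along special vertices (`IsDDG.exists_isSpecialSystem`).

For `σ = id` these coincidences say that special vertices form the columns of a grid. For one
transposition they define columns up to a fixed-point-free involution inside two rows, which is the
central symmetry after renumbering. For two transpositions, reversing adjacencies between paired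
classes gives a graph with exactly one neighbour of each vertex in each class. Its components are
found separately: if a vertex has a twin (same neighbours, different class), so has its whole
component, which is some `C_{4r}[K̄₂]`; otherwise the coincidences orient each vertex, adjacent
vertices have opposite orientations, and the component is a 4-cube
(`IsSquareSystem.exists_equiv_sigma`). -/

/-! ### Equitability of the canonical partition. -/

/-- The number of neighbours of `x` in the class `j`. -/
noncomputable def nbrCount {V : Type*} (G : SimpleGraph V) {m : ℕ} (cls : V → Fin m) (x : V)
    (j : Fin m) : ℕ :=
  {y | G.Adj x y ∧ cls y = j}.ncard

/-- The number of common neighbours of `x` and `y` in the class `j`. -/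
noncomputable def commonCount {V : Type*} (G : SimpleGraph V) {m : ℕ} (cls : V → Fin m) (x y : V)
    (j : Fin m) : ℕ :=
  {z | (G.Adj x z ∧ G.Adj y z) ∧ cls z = j}.ncard

theorem sum_ncard_fiber {V : Type*} [Finite V] {m : ℕ} (cls : V → Fin m) (p : V → Prop) :
    ∑ j, {z | p z ∧ cls z = j}.ncard = {z | p z}.ncard := by
  classical
  have := Fintype.ofFinite V
  have h : ∀ j, {z | p z ∧ cls z = j}.ncard = ((Finset.univ.filter p).filter (cls · = j)).card := by
    intro j
    rw [← Set.ncard_coe_finset]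
    congr 1
    ext z
    simp
  rw [Finset.sum_congr rfl fun j _ => h j,
    ← Finset.card_eq_sum_card_fiberwise (fun x _ => Finset.mem_coe.2 (Finset.mem_univ _)),
    ← Set.ncard_coe_finset]
  simp

theorem sum_nbrCount {V : Type*} [Finite V] (G : SimpleGraph V) {m : ℕ} (cls : V → Fin m) (x : V) :
    ∑ j, nbrCount G cls x j = (G.neighborSet x).ncard :=
  sum_ncard_fiber cls _

theorem sum_commonCount {V : Type*} [Finite V] (G : SimpleGraph V) {m : ℕ} (cls : V → Fin m)
    (x y : V) : ∑ j, commonCount G cls x y j = (G.commonNeighbors x y).ncard :=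
  sum_ncard_fiber cls _

/-- The 0-1 matrix of the relation `being in the same class`. -/
def classMatrix {V : Type*} {m : ℕ} (cls : V → Fin m) : Matrix V V ℤ :=
  Matrix.of fun x y => if cls x = cls y then 1 else 0

section

variable {V : Type*} {G : SimpleGraph V} {v k l1 l2 m n : ℕ} {cls : V → Fin m}

theorem IsDDG.exists_mem_class (h : IsDDG G v k l1 l2 m n cls) (hn : n ≠ 0) (i : Fin m) :
    ∃ x, cls x = i := by
  have : {x | cls x = i}.Nonempty := by
    apply Set.nonempty_of_ncard_ne_zero
    rwa [h.card_class]
  exact this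

variable [Fintype V] [DecidableRel G.Adj]

theorem adjMatrix_mul_classMatrix_apply (G : SimpleGraph V) [DecidableRel G.Adj] (cls : V → Fin m)
    (x y : V) : (G.adjMatrix ℤ * classMatrix cls) x y = nbrCount G cls x (cls y) := by
  rw [SimpleGraph.adjMatrix_mul_apply, nbrCount]
  simp only [classMatrix, of_apply]
  rw [Finset.sum_boole, ← Set.ncard_coe_finset]
  congr 2
  ext z
  simp

theorem classMatrix_mul_adjMatrix_apply (G : SimpleGraph V) [DecidableRel G.Adj] (cls : V → Fin m)
    (x y : V) : (classMatrix cls * G.adjMatrix ℤ) x y = nbrCount G cls y (cls x) := by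
  have h : (classMatrix cls)ᵀ = classMatrix cls := by
    ext a b
    simp [classMatrix, eq_comm]
  rw [← adjMatrix_mul_classMatrix_apply, ← transpose_apply (G.adjMatrix ℤ * _), transpose_mul,
    SimpleGraph.transpose_adjMatrix, h]

variable [DecidableEq V]

theorem IsDDG.adjMatrix_sq (h : IsDDG G v k l1 l2 m n cls) :
    G.adjMatrix ℤ * G.adjMatrix ℤ = ((k : ℤ) - l1) • (1 : Matrix V V ℤ) +
      ((l1 : ℤ) - l2) • classMatrix cls + (l2 : ℤ) • (Matrix.of fun _ _ => 1) := by
  have key : ∀ x y, (G.adjMatrix ℤ * G.adjMatrix ℤ) x y = (G.commonNeighbors x y).ncard := by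
    intro x y
    rw [SimpleGraph.adjMatrix_mul_apply]
    simp only [SimpleGraph.adjMatrix_apply]
    rw [Finset.sum_boole, ← Set.ncard_coe_finset]
    congr 2
    ext z
    simp [SimpleGraph.mem_commonNeighbors, G.adj_comm]
  ext x y
  rw [key, Matrix.add_apply, Matrix.add_apply, Matrix.smul_apply, Matrix.smul_apply,
    Matrix.smul_apply, Matrix.one_apply]
  simp only [classMatrix, of_apply, smul_eq_mul]
  by_cases hxy : x = y
  · subst hxy
    have : G.commonNeighbors x x = G.neighborSet x := by simp [SimpleGraph.commonNeighbors]
    simp [this, h.regular]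
  · by_cases hc : cls x = cls y
    · simp [h.same_class x y hxy hc, hc, hxy]
    · simp [h.diff_class x y hc, hc, hxy]

/-- In a proper divisible design graph the adjacency matrix commutes with the class matrix. -/
theorem IsDDG.nbrCount_comm (h : IsDDG G v k l1 l2 m n cls) (hne : l1 ≠ l2) (x y : V) :
    nbrCount G cls x (cls y) = nbrCount G cls y (cls x) := by
  have hdeg : ∀ z, G.degree z = k := fun z => by
    rw [← h.regular z, ← SimpleGraph.card_neighborFinset_eq_degree, ← Set.ncard_coe_finset,
      SimpleGraph.coe_neighborFinset]
  have hJ : G.adjMatrix ℤ * (Matrix.of fun _ _ => 1) = (Matrix.of fun _ _ => 1) * G.adjMatrix ℤ := by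
    ext a b
    rw [SimpleGraph.adjMatrix_mul_apply, SimpleGraph.mul_adjMatrix_apply]
    simp [hdeg]
  -- In `A² A = A A²` the identity and all-ones terms cancel; what remains is `l1 - l2` times the
  -- commutator of `A` with the class matrix.
  have hass := Matrix.mul_assoc (G.adjMatrix ℤ) (G.adjMatrix ℤ) (G.adjMatrix ℤ)
  rw [h.adjMatrix_sq] at hass
  simp only [Matrix.add_mul, Matrix.mul_add, Matrix.smul_mul, Matrix.mul_smul, Matrix.one_mul,
    Matrix.mul_one, hJ, add_left_inj, add_right_inj] at hass
  have h1 := congrFun (congrFun hass x) y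
  simp only [Matrix.smul_apply, adjMatrix_mul_classMatrix_apply,
    classMatrix_mul_adjMatrix_apply, smul_eq_mul] at h1
  have h2 : (l1 : ℤ) - l2 ≠ 0 := by
    rw [sub_ne_zero]; exact_mod_cast hne
  exact_mod_cast (mul_left_cancel₀ h2 h1).symm

/-- The canonical partition of a proper divisible design graph is equitable; its quotient matrix is
symmetric and satisfies the quotient of the equation for the square of the adjacency matrix. -/
theorem IsDDG.exists_isQuotientMatrix (h : IsDDG G v k l1 l2 m n cls) (hne : l1 ≠ l2)
    (hn : n ≠ 0) :
    ∃ R : Matrix (Fin m) (Fin m) ℕ, IsQuotientMatrix G cls R ∧ (∀ i j, R i j = R j i) ∧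
      (∀ i, ∑ j, R i j = k) ∧
      ∀ i j, ∑ a, (R i a : ℤ) * R a j =
        (if i = j then (k : ℤ) - l1 + (l1 - l2) * n else 0) + l2 * n := by
  choose r hr using h.exists_mem_class hn
  have hq : ∀ x j, nbrCount G cls x j = nbrCount G cls (r (cls x)) j := by
    intro x j
    have h1 := h.nbrCount_comm hne x (r j)
    have h2 := h.nbrCount_comm hne (r (cls x)) (r j)
    rw [hr] at h1
    rw [hr, hr] at h2
    rw [h1, h2]
  refine ⟨fun i j => nbrCount G cls (r i) j, hq, ?_, ?_, ?_⟩
  · intro i j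
    have h2 := h.nbrCount_comm hne (r i) (r j)
    rwa [hr, hr] at h2
  · intro i
    rw [sum_nbrCount, h.regular]
  · intro i j
    -- The square of the quotient matrix is read off from `A (A K)` at class representatives;
    -- reassociating to `A² K` allows the design equation, `K² = nK` and `JK = nJ` to be used.
    have e1 : (G.adjMatrix ℤ * (G.adjMatrix ℤ * classMatrix cls)) (r i) (r j) =
        ∑ a, (nbrCount G cls (r i) a : ℤ) * nbrCount G cls (r a) j := by
      rw [SimpleGraph.adjMatrix_mul_apply,
        ← Finset.sum_fiberwise_of_maps_to (t := Finset.univ) (g := cls) (fun _ _ => Finset.mem_univ _)]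
      refine Finset.sum_congr rfl fun a _ => ?_
      have : ∀ z ∈ (G.neighborFinset (r i)).filter (cls · = a),
          (G.adjMatrix ℤ * classMatrix cls) z (r j) = nbrCount G cls (r a) j := by
        intro z hz
        rw [adjMatrix_mul_classMatrix_apply, hr, hq, (Finset.mem_filter.1 hz).2]
      rw [Finset.sum_congr rfl this, Finset.sum_const, nsmul_eq_mul]
      congr 2
      rw [nbrCount, ← Set.ncard_coe_finset]
      congr 1
      ext z
      simp
    rw [← e1, ← Matrix.mul_assoc, h.adjMatrix_sq]
    have e2 : ∀ c : Fin m, ((Finset.univ.filter fun x => cls x = c).card : ℤ) = n := by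
      intro c
      rw [← h.card_class c, ← Set.ncard_coe_finset]
      simp
    have e3 : ∀ c : Fin m, (∑ x : V, if cls x = c then (1 : ℤ) else 0) = n := by
      intro c
      rw [Finset.sum_boole, e2]
    have e4 : (classMatrix cls * classMatrix cls) (r i) (r j) = if i = j then (n : ℤ) else 0 := by
      simp only [Matrix.mul_apply, classMatrix, of_apply, hr]
      split_ifs with hij
      · subst hij
        rw [← e3 i]
        refine Finset.sum_congr rfl fun x _ => ?_
        by_cases hx : cls x = i
        · simp [hx]
        · simp [hx, Ne.symm hx]
      · refine Finset.sum_eq_zero fun x _ => ?_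
        by_cases hx : cls x = j
        · simp [hx, hij]
        · simp [hx]
    have e5 : ((Matrix.of fun _ _ => 1 : Matrix V V ℤ) * classMatrix cls) (r i) (r j) = n := by
      simp only [Matrix.mul_apply, classMatrix, of_apply, hr, one_mul, e3]
    rw [Matrix.add_mul, Matrix.add_mul, Matrix.smul_mul, Matrix.smul_mul, Matrix.smul_mul,
      Matrix.one_mul, Matrix.add_apply, Matrix.add_apply, Matrix.smul_apply, Matrix.smul_apply,
      Matrix.smul_apply, e4, e5]
    simp only [classMatrix, of_apply, hr, smul_eq_mul]
    split_ifs <;> ring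

end

/-- A class of odd size is not odd-regular. -/
theorem even_nbrCount_of_odd {V : Type*} [Finite V] {G : SimpleGraph V} {m n d : ℕ}
    {cls : V → Fin m} {i : Fin m} (hn : Odd n) (hc : {x | cls x = i}.ncard = n)
    (hd : ∀ x, cls x = i → nbrCount G cls x i = d) : Even d := by
  classical
  have := Fintype.ofFinite V
  by_contra hodd
  have h := (G.induce {x | cls x = i}).even_card_odd_degree_vertices
  have hdeg : ∀ x, (G.induce {x | cls x = i}).degree x = d := by
    rintro ⟨x, hx⟩
    rw [← hd x hx, nbrCount, ← SimpleGraph.card_neighborSet_eq_degree, ← Nat.card_eq_fintype_card,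
      ← Nat.card_coe_set_eq]
    refine Nat.card_congr ⟨fun y => ⟨y.1.1, y.2, y.1.2⟩, fun y => ⟨⟨y.1, y.2.2⟩, y.2.1⟩, ?_, ?_⟩
    · intro y; rfl
    · intro y; rfl
  simp only [hdeg, Nat.not_even_iff_odd.1 hodd, Finset.filter_true, Finset.card_univ] at h
  rw [← Nat.card_eq_fintype_card, Nat.card_coe_set_eq, hc] at h
  exact Nat.not_even_iff_odd.2 hn h

theorem IsDDG.perm {V : Type*} {G : SimpleGraph V} {v k l1 l2 m n : ℕ} {cls : V → Fin m}
    (h : IsDDG G v k l1 l2 m n cls) (π : Equiv.Perm (Fin m)) : IsDDG G v k l1 l2 m n (π ∘ cls) where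
  card_vertices := h.card_vertices
  regular := h.regular
  card_class i := by
    rw [← h.card_class (π.symm i)]
    congr 1
    ext x
    simp [Equiv.eq_symm_apply]
  same_class x y hxy hc := h.same_class x y hxy (π.injective hc)
  diff_class x y hc := h.diff_class x y fun h' => hc (congrArg π h')

theorem IsQuotientMatrix.perm {V : Type*} {G : SimpleGraph V} {m : ℕ} {cls : V → Fin m}
    {R : Matrix (Fin m) (Fin m) ℕ} (h : IsQuotientMatrix G cls R) (π : Equiv.Perm (Fin m)) :
    IsQuotientMatrix G (π ∘ cls) (fun i j => R (π.symm i) (π.symm j)) := by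
  intro x j
  simp only [Function.comp_apply, Equiv.symm_apply_apply, ← h x (π.symm j), Equiv.eq_symm_apply]

/-! ### Integral solutions for the quotient matrix. -/

/-- The two equations say that the second elementary symmetric function vanishes. If `a ≥ 0`, all
products are zero and only `d` can survive. For `a = b = -1` it becomes `(c - 2)(d - 2) = 3`; for `a
= -1 < b` it becomes `bc + cd + db = b + c + d`, which bounds `b` by `1`. The condition `N ≠ 2`
removes `(-1, 1, 1, 1)`. -/
theorem sorted_tuple_cases {a b c d N : ℤ} (h0 : 0 ≤ N) (hN : N ≠ 2) (ha : -1 ≤ a) (hab : a ≤ b)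
    (hbc : b ≤ c) (hcd : c ≤ d) (hs : a + b + c + d = N)
    (hq : a * a + b * b + c * c + d * d = N * N) :
    (a = 0 ∧ b = 0 ∧ c = 0 ∧ d = N) ∨ (N = 3 ∧ a = -1 ∧ b = 0 ∧ c = 2 ∧ d = 2) ∨
      (N = 6 ∧ a = -1 ∧ b = -1 ∧ c = 3 ∧ d = 5) := by
  subst hs
  rcases ha.eq_or_lt with rfl | ha
  · rcases hab.eq_or_lt with rfl | hb
    · have h1 : (c - 2) * (d - 2) = 3 := by linarith
      rcases hbc.eq_or_lt with rfl | hc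
      · omega
      have hc' : c ≤ 3 := by nlinarith
      have : 0 ≤ c := by omega
      interval_cases c <;> omega
    · have h1 : b * c + c * d + d * b = b + c + d := by linarith
      have h2 : b ≤ 1 := by nlinarith
      have : 0 ≤ b := by omega
      interval_cases b
      · have h3 : c ≤ 2 := by nlinarith
        interval_cases c <;> omega
      · have h3 : c * d = 1 := by linarith
        have h4 : c ≤ 1 := by nlinarith
        interval_cases c
        omega
  · have h1 : b * c + c * d + d * b + a * (b + c + d) = 0 := by linarith
    have ha' : 0 ≤ a := by omega
    have h2 : c * c ≤ 0 := by
      have := mul_nonneg ha' (by omega : 0 ≤ b + c + d)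
      have := mul_nonneg (by omega : 0 ≤ b) (by omega : 0 ≤ c)
      have := mul_nonneg (by omega : 0 ≤ d) (by omega : 0 ≤ b)
      nlinarith
    have h3 : c = 0 := by
      have := mul_self_nonneg c
      exact mul_self_eq_zero.1 (by omega)
    omega

theorem quotient_row_cases {N : ℤ} (h0 : 0 ≤ N) (hN : N ≠ 2) (q : Fin 4 → ℤ) (h1 : ∀ i, -1 ≤ q i)
    (hs : ∑ i, q i = N) (hq : ∑ i, q i * q i = N * N) :
    (∃ m, ∀ j, q j = if m = j then N else 0) ∨
      (N = 3 ∧ ∃ π : Equiv.Perm (Fin 4), ∀ j, q j = (![-1, 0, 2, 2] : Fin 4 → ℤ) (π j)) ∨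
      (N = 6 ∧ ∃ π : Equiv.Perm (Fin 4), ∀ j, q j = (![-1, -1, 3, 5] : Fin 4 → ℤ) (π j)) := by
  obtain ⟨τ, hτ⟩ : ∃ τ : Equiv.Perm (Fin 4), Monotone (q ∘ τ) := ⟨_, Tuple.monotone_sort q⟩
  have hs' : ∑ i, q (τ i) = N := (Equiv.sum_comp τ q).trans hs
  have hq' : ∑ i, q (τ i) * q (τ i) = N * N := (Equiv.sum_comp τ fun i => q i * q i).trans hq
  rw [Fin.sum_univ_four] at hs' hq'
  have key : ∀ w : Fin 4 → ℤ, (∀ i, q (τ i) = w i) → ∀ j, q j = w (τ.symm j) := by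
    intro w hw j
    rw [← hw, Equiv.apply_symm_apply]
  rcases sorted_tuple_cases h0 hN (h1 _) (hτ (by decide : (0 : Fin 4) ≤ 1))
    (hτ (by decide : (1 : Fin 4) ≤ 2)) (hτ (by decide : (2 : Fin 4) ≤ 3)) hs' hq' with
    ⟨h0, h1, h2, h3⟩ | ⟨hN, h0, h1, h2, h3⟩ | ⟨hN, h0, h1, h2, h3⟩
  · refine Or.inl ⟨τ 3, fun j => ?_⟩
    rw [key ![0, 0, 0, N] (by intro i; fin_cases i <;> assumption)]
    obtain ⟨i, rfl⟩ := τ.surjective j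
    simp only [Equiv.symm_apply_apply, τ.injective.eq_iff]
    fin_cases i <;> rfl
  · exact Or.inr (Or.inl ⟨hN, τ.symm, key _ (by intro i; fin_cases i <;> assumption)⟩)
  · exact Or.inr (Or.inr ⟨hN, τ.symm, key _ (by intro i; fin_cases i <;> assumption)⟩)

/-- A row of the sporadic quotient matrix for `n = 5`, reduced by one; `t` is the position of
the entry zero, or `i` for the row with a single nonzero entry. -/
def sporadicRow (i t j : Fin 4) : ℤ :=
  if t = i then (if j = i then 3 else 0) else if j = i then -1 else if j = t then 0 else 2

/-- The only odd entry is `-1`, so it stands on the diagonal and the row is determined by the place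
of its zero. -/
theorem exists_sporadicRow : ∀ (π : Equiv.Perm (Fin 4)) (i : Fin 4),
    (![-1, 0, 2, 2] : Fin 4 → ℤ) (π i) % 2 = 1 →
    ∃ t, ∀ j, (![-1, 0, 2, 2] : Fin 4 → ℤ) (π j) = sporadicRow i t j := by
  decide

/-- Besides `3I`, symmetry and orthogonality leave only the block sum of `(3)`, at position `b`, and
the `3 × 3` matrix `2J - 3I`. -/
theorem sporadicRow_cases : ∀ t0 t1 t2 t3 : Fin 4,
    (∀ i j, sporadicRow i (![t0, t1, t2, t3] i) j = sporadicRow j (![t0, t1, t2, t3] j) i) →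
    (∀ i j, i ≠ j → ∑ a, sporadicRow i (![t0, t1, t2, t3] i) a *
      sporadicRow j (![t0, t1, t2, t3] j) a = 0) →
    (∀ i, ![t0, t1, t2, t3] i = i) ∨ ∃ b, ∀ i, ![t0, t1, t2, t3] i = b := by
  decide

theorem orthogonal_row_six : ∀ ρ : Equiv.Perm (Fin 4),
    ∑ a, (![-1, -1, 3, 5] : Fin 4 → ℤ) a * (![-1, -1, 3, 5] : Fin 4 → ℤ) (ρ a) = 0 →
    (![-1, -1, 3, 5] : Fin 4 → ℤ) (ρ 2) = 3 := by
  decide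

theorem six_row_ne_zero : ∀ a, (![-1, -1, 3, 5] : Fin 4 → ℤ) a ≠ 0 := by
  decide

/-- The integral solutions for the quotient matrix, reduced by one. -/
theorem quotient_cases {N : ℤ} (h0 : 0 ≤ N) (hN : N ≠ 2) (q : Fin 4 → Fin 4 → ℤ)
    (h1 : ∀ i j, -1 ≤ q i j) (hsymm : ∀ i j, q i j = q j i) (hs : ∀ i, ∑ j, q i j = N)
    (hq : ∀ i j, ∑ a, q i a * q j a = if i = j then N * N else 0)
    (hodd : N % 2 = 1 → ∀ i, q i i % 2 = 1) :
    (∃ σ : Fin 4 → Fin 4, (∀ i, σ (σ i) = i) ∧ ∀ i j, q i j = if σ i = j then N else 0) ∨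
      (N = 3 ∧ ∃ b, ∀ i j, q i j = sporadicRow i b j) := by
  have hrow := fun i => quotient_row_cases h0 hN (q i) (h1 i) (hs i) (by simpa using hq i i)
  by_cases hN0 : N = 0
  -- For `N = 0` the matrix vanishes and does not determine an involution; the identity serves.
  · refine Or.inl ⟨id, fun _ => rfl, fun i j => ?_⟩
    subst hN0
    rcases hrow i with ⟨m, hm⟩ | ⟨h, -⟩ | ⟨h, -⟩
    · simp [hm]
    · omega
    · omega
  by_cases hall : ∀ i, ∃ m, ∀ j, q i j = if m = j then N else 0
  · choose σ hσ using hall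
    refine Or.inl ⟨σ, fun i => ?_, hσ⟩
    by_contra h
    have h2 := hsymm i (σ i)
    rw [hσ, hσ, if_pos rfl, if_neg h] at h2
    exact hN0 h2
  · push Not at hall
    obtain ⟨i, hi⟩ := hall
    rcases hrow i with ⟨m, hm⟩ | ⟨rfl, -⟩ | ⟨rfl, π, hπ⟩
    · obtain ⟨j, hj⟩ := hi m
      exact (hj (hm j)).elim
    · have ht : ∀ i, ∃ t, ∀ j, q i j = sporadicRow i t j := by
        intro i
        rcases hrow i with ⟨m, hm⟩ | ⟨-, π, hπ⟩ | ⟨h, -⟩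
        · have hmi : m = i := by
            by_contra hne
            have := hodd (by norm_num) i
            rw [hm, if_neg hne] at this
            omega
          exact ⟨i, fun j => by simp [hm, sporadicRow, hmi, eq_comm]⟩
        · have := hodd (by norm_num) i
          rw [hπ] at this
          obtain ⟨t, ht⟩ := exists_sporadicRow π i this
          exact ⟨t, fun j => by rw [hπ, ht]⟩
        · omega
      choose t ht using ht
      have ht4 : t = ![t 0, t 1, t 2, t 3] := by
        funext i; fin_cases i <;> rfl
      rcases sporadicRow_cases (t 0) (t 1) (t 2) (t 3)
        (by rw [← ht4]; intro i j; rw [← ht, ← ht, hsymm])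
        (by rw [← ht4]; intro i j hij; simp only [← ht, hq, if_neg hij]) with h | ⟨b, hb⟩
      · rw [← ht4] at h
        obtain ⟨j, hj⟩ := hi i
        refine (hj ?_).elim
        simp [ht, h, sporadicRow, eq_comm]
      · rw [← ht4] at hb
        exact Or.inr ⟨rfl, b, fun i j => by rw [ht, hb]⟩
    · exfalso
      -- Orthogonality puts a `3` into this column of every row. By symmetry some row then consists
      -- of four `3`s, and its sum is `12` instead of `6`.
      have hcol : ∀ j, q j (π.symm 2) = 3 := by
        intro j
        by_cases hij : i = j
        · subst hij; rw [hπ]; simp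
        have hdot := hq i j
        rw [if_neg hij] at hdot
        rcases hrow j with ⟨m, hm⟩ | ⟨h, -⟩ | ⟨-, π', hπ'⟩
        · simp [hm] at hdot
          rw [hπ] at hdot
          exact (six_row_ne_zero _ hdot).elim
        · omega
        · rw [hπ']
          apply orthogonal_row_six (π.symm.trans π')
          rw [← hdot, ← Equiv.sum_comp π]
          simp [hπ, hπ']
      have := hs (π.symm 2)
      simp [hsymm (π.symm 2), hcol] at this

/-! ### Unique neighbours, and the exclusion of the sporadic matrix for `n = 5`. -/

section

variable {V : Type*} {G : SimpleGraph V} {m n : ℕ} {cls : V → Fin m}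

theorem exists_unique_nbr {x : V} {j : Fin m} (h : nbrCount G cls x j = 1) :
    ∃ u, cls u = j ∧ ∀ z, cls z = j → (G.Adj x z ↔ z = u) := by
  obtain ⟨u, hu⟩ := Set.ncard_eq_one.1 h
  have hu' := fun z => Set.ext_iff.1 hu z
  simp only [Set.mem_ofPred_eq, Set.mem_singleton_iff] at hu'
  exact ⟨u, ((hu' u).2 rfl).2, fun z hz => by rw [← hu']; tauto⟩

theorem exists_unique_nonnbr [Finite V] {x : V} {j : Fin m} (hn : 1 ≤ n) (hc : {z | cls z = j}.ncard = n)
    (h : nbrCount G cls x j = n - 1) :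
    ∃ u, cls u = j ∧ ∀ z, cls z = j → (G.Adj x z ↔ z ≠ u) := by
  have hsub : {y | G.Adj x y ∧ cls y = j} ⊆ {z | cls z = j} := fun z hz => hz.2
  have hd := Set.ncard_sdiff hsub
  rw [hc, show {y | G.Adj x y ∧ cls y = j}.ncard = n - 1 from h, Nat.sub_sub_self hn] at hd
  obtain ⟨u, hu⟩ := Set.ncard_eq_one.1 hd
  have hu' := fun z => Set.ext_iff.1 hu z
  simp only [Set.mem_sdiff, Set.mem_ofPred_eq, Set.mem_singleton_iff] at hu'
  refine ⟨u, ((hu' u).2 rfl).1, fun z hz => ?_⟩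
  rw [Ne, ← hu']
  tauto

theorem commonCount_comm (x y : V) (j : Fin m) : commonCount G cls x y j = commonCount G cls y x j := by
  simp only [commonCount, and_comm]

open Classical in
theorem commonCount_of_unique_nbr {x y u : V} {j : Fin m} (hu : cls u = j)
    (h : ∀ z, cls z = j → (G.Adj x z ↔ z = u)) :
    commonCount G cls x y j = if G.Adj y u then 1 else 0 := by
  rw [commonCount]
  split_ifs with hy
  · rw [Set.ncard_eq_one]
    refine ⟨u, Set.ext fun z => ?_⟩
    simp only [Set.mem_ofPred_eq, Set.mem_singleton_iff]
    constructor
    · rintro ⟨⟨h1, -⟩, h2⟩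
      exact (h z h2).1 h1
    · rintro rfl
      exact ⟨⟨(h z hu).2 rfl, hy⟩, hu⟩
  · convert Set.ncard_empty V using 2
    refine Set.eq_empty_of_forall_notMem ?_
    rintro z ⟨⟨h1, h3⟩, h2⟩
    exact hy ((h z h2).1 h1 ▸ h3)

theorem commonCount_of_nbrCount_eq_zero [Finite V] {x y : V} {j : Fin m}
    (h : nbrCount G cls x j = 0) :
    commonCount G cls x y j = 0 := by
  have := (Set.ncard_eq_zero).1 h
  rw [commonCount, Set.ncard_eq_zero]
  refine Set.eq_empty_of_forall_notMem ?_
  rintro z ⟨⟨h1, -⟩, h2⟩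
  exact Set.eq_empty_iff_forall_notMem.1 this z ⟨h1, h2⟩

end

theorem fin_four_others : ∀ b : Fin 4, ∃ i j k : Fin 4, i ≠ b ∧ j ≠ b ∧ k ≠ b ∧ i ≠ j ∧ i ≠ k ∧ j ≠ k := by
  decide

theorem fin_four_fourth : ∀ b i j : Fin 4, ∃ k, k ≠ b ∧ i ≠ k ∧ j ≠ k := by
  decide

theorem fin_four_sum : ∀ b i j k : Fin 4, i ≠ b → j ≠ b → k ≠ b → i ≠ j → i ≠ k → j ≠ k →
    Finset.univ = ({b, i, j, k} : Finset (Fin 4)) := by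
  decide

/-- Class `b` is a 5-clique matched to each of the other three classes, so the vertex `f p i` is
labelled by `p` in class `b` and by its class `i`. For fixed `i ≠ j`, adjacency of `f p i` and `f q
j` defines a tournament on class `b` with all out-degrees `2`. The two out-neighbours of a point are
joined by an arc, which yields a transitive triple, and this produces three common neighbours where
only two are allowed. -/
theorem not_sporadic {V : Type*} [Finite V] {G : SimpleGraph V} {cls : V → Fin 4} {v k l1 : ℕ}
    (hG : IsDDG G v k l1 2 4 5 cls) {b : Fin 4}
    (hb : ∀ x j, (nbrCount G cls x j : ℤ) = 1 + sporadicRow (cls x) b j) : False := by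
  classical
  have hnb : ∀ p, ∀ i, ∃ u, cls p = b → i ≠ b →
      cls u = i ∧ ∀ z, cls z = i → (G.Adj p z ↔ z = u) := by
    intro p i
    by_cases hp : cls p = b
    · by_cases hi : i = b
      · exact ⟨p, fun _ h => (h hi).elim⟩
      have := hb p i
      rw [sporadicRow, if_pos hp.symm, hp, if_neg hi] at this
      obtain ⟨u, hu⟩ := exists_unique_nbr (by omega : nbrCount G cls p i = 1)
      exact ⟨u, fun _ _ => hu⟩
    · exact ⟨p, fun h => (hp h).elim⟩
  choose f hf using hnb
  have hfc : ∀ p i, cls p = b → i ≠ b → cls (f p i) = i := fun p i hp hi => (hf p i hp hi).1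
  have hadj : ∀ p i, cls p = b → i ≠ b → G.Adj p (f p i) := fun p i hp hi =>
    ((hf p i hp hi).2 _ (hfc p i hp hi)).2 rfl
  have hback : ∀ p i, cls p = b → i ≠ b → ∀ z, cls z = b → (G.Adj (f p i) z ↔ z = p) := by
    intro p i hp hi
    have := hb (f p i) b
    rw [hfc p i hp hi, sporadicRow, if_neg hi.symm, if_neg hi.symm, if_pos rfl] at this
    obtain ⟨u, hu, hu'⟩ := exists_unique_nbr (by omega : nbrCount G cls (f p i) b = 1)
    obtain rfl := (hu' p hp).1 (hadj p i hp hi).symm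
    exact hu'
  have hclique : ∀ p q, cls p = b → cls q = b → p ≠ q → G.Adj p q := by
    intro p q hp hq hpq
    have := hb p b
    rw [hp, sporadicRow, if_pos rfl, if_pos rfl] at this
    obtain ⟨u, hu, hu'⟩ := exists_unique_nonnbr (by norm_num) (hG.card_class b)
      (show nbrCount G cls p b = 5 - 1 by omega)
    have hpu : p = u := by
      by_contra h
      exact G.loopless.irrefl p ((hu' p hp).2 h)
    exact (hu' q hq).2 (hpu ▸ hpq.symm)
  have hdiff : ∀ x y, cls x ≠ cls y → ∑ a, commonCount G cls x y a = 2 := fun x y hxy => by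
    rw [sum_commonCount, hG.diff_class x y hxy]
  have hzero : ∀ x, cls x ≠ b → nbrCount G cls x (cls x) = 0 := by
    intro x hx
    have := hb x (cls x)
    rw [sporadicRow, if_neg (Ne.symm hx), if_pos rfl] at this
    omega
  -- The common neighbours of `f p i` and `q` are counted by class: class `b` contributes unless `p
  -- = q`, and class `i` contributes nothing because it contains no edges.
  have hxor : ∀ i j k p q, i ≠ b → j ≠ b → k ≠ b → i ≠ j → i ≠ k → j ≠ k → cls p = b → cls q = b →
      (if p = q then 0 else 1) + (if G.Adj (f p i) (f q j) then 1 else 0) +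
        (if G.Adj (f p i) (f q k) then 1 else 0) = 2 := by
    intro i j k p q hi hj hk hij hik hjk hp hq
    rw [← hdiff (f p i) q (by rw [hfc p i hp hi, hq]; exact hi), fin_four_sum b i j k hi hj hk hij hik hjk,
      Finset.sum_insert (by simp [hi.symm, hj.symm, hk.symm]), Finset.sum_insert (by simp [hij, hik]),
      Finset.sum_pair hjk, commonCount_of_unique_nbr hp (hback p i hp hi),
      commonCount_of_nbrCount_eq_zero, commonCount_comm _ _ j, commonCount_comm _ _ k,
      commonCount_of_unique_nbr (hf q j hq hj).1 (hf q j hq hj).2,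
      commonCount_of_unique_nbr (hf q k hq hk).1 (hf q k hq hk).2]
    · have : G.Adj q p ↔ ¬ p = q := ⟨fun h h' => G.loopless.irrefl q (h' ▸ h),
        fun h => hclique q p hq hp (Ne.symm h)⟩
      simp only [this]
      split_ifs <;> omega
    · have := hzero (f p i) (by rwa [hfc p i hp hi])
      rwa [hfc p i hp hi] at this
  have hdiag : ∀ i j p, i ≠ b → j ≠ b → i ≠ j → cls p = b → G.Adj (f p i) (f p j) := by
    intro i j p hi hj hij hp
    obtain ⟨k, hk, hik, hjk⟩ : ∃ k, k ≠ b ∧ i ≠ k ∧ j ≠ k :=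
      fin_four_fourth b i j
    have := hxor i j k p p hi hj hk hij hik hjk hp hp
    by_contra h
    rw [if_pos rfl, if_neg h] at this
    split_ifs at this <;> omega
  have hswap : ∀ i j k p q, i ≠ b → j ≠ b → k ≠ b → i ≠ j → i ≠ k → j ≠ k → cls p = b →
      cls q = b → p ≠ q → (G.Adj (f p i) (f q j) ↔ ¬ G.Adj (f p i) (f q k)) := by
    intro i j k p q hi hj hk hij hik hjk hp hq hpq
    have := hxor i j k p q hi hj hk hij hik hjk hp hq
    rw [if_neg hpq] at this
    split_ifs at this <;> first | omega | tauto
  obtain ⟨i, j, k, hi, hj, hk, hij, hik, hjk⟩ := fin_four_others b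
  have h1 : ∀ p q, cls p = b → cls q = b → p ≠ q →
      (G.Adj (f p i) (f q k) ↔ ¬ G.Adj (f p i) (f q j)) := fun p q hp hq hpq =>
    hswap i k j p q hi hk hj hik hij hjk.symm hp hq hpq
  have h2 : ∀ p q, cls p = b → cls q = b → p ≠ q →
      (G.Adj (f p j) (f q k) ↔ G.Adj (f p i) (f q j)) := by
    intro p q hp hq hpq
    have e1 := hswap k i j q p hk hi hj hik.symm hjk.symm hij hq hp hpq.symm
    rw [G.adj_comm (f q k), G.adj_comm (f q k)] at e1
    have e2 := h1 p q hp hq hpq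
    tauto
  -- The tournament property.
  have h3 : ∀ p q, cls p = b → cls q = b → p ≠ q →
      (G.Adj (f q i) (f p j) ↔ ¬ G.Adj (f p i) (f q j)) := by
    intro p q hp hq hpq
    have e1 := hswap j i k p q hj hi hk hij.symm hjk hik hp hq hpq
    rw [G.adj_comm (f p j)] at e1
    rw [e1, h2 p q hp hq hpq]
  -- In a transitive triple with arcs from `q` to `r`, from `r` to `p` and from `q` to `p`, the
  -- vertices `f p k`, `f q k`, `f r k` are all common neighbours of `f p i` and `f q j`.
  have h4 : ∀ p q r, cls p = b → cls q = b → cls r = b → q ≠ p → r ≠ p → q ≠ r →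
      G.Adj (f q i) (f p j) → G.Adj (f r i) (f p j) → G.Adj (f q i) (f r j) → False := by
    intro p q r hp hq hr hqp hrp hqr a1 a2 a3
    have hinj : ∀ s t, cls s = b → cls t = b → f s k = f t k → s = t := fun s t hs ht h =>
      ((hback t k ht hk s hs).1 (h ▸ (hadj s k hs hk).symm))
    have hsub : ((({f p k, f q k, f r k} : Finset V)) : Set V) ⊆ G.commonNeighbors (f p i) (f q j) := by
      intro z hz
      simp only [Finset.coe_insert, Finset.coe_singleton, Set.mem_insert_iff,
        Set.mem_singleton_iff] at hz
      rcases hz with rfl | rfl | rfl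
      · exact ⟨hdiag i k p hi hk hik hp, (h2 q p hq hp hqp).2 a1⟩
      · exact ⟨(h1 p q hp hq hqp.symm).2 ((h3 q p hq hp hqp).not.2 (not_not.2 a1)),
          hdiag j k q hj hk hjk hq⟩
      · exact ⟨(h1 p r hp hr hrp.symm).2 ((h3 r p hr hp hrp).not.2 (not_not.2 a2)),
          (h2 q r hq hr hqr).2 a3⟩
    have hle := Set.ncard_le_ncard hsub
    rw [hG.diff_class _ _ (by rw [hfc p i hp hi, hfc q j hq hj]; exact hij), Set.ncard_coe_finset,
      Finset.card_eq_three.2 ⟨_, _, _, fun h => hqp (hinj _ _ hp hq h).symm,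
        fun h => hrp (hinj _ _ hp hr h).symm, fun h => hqr (hinj _ _ hq hr h), rfl⟩] at hle
    omega
  obtain ⟨q, hq⟩ := hG.exists_mem_class (by norm_num) b
  have hdeg : {z | G.Adj (f q i) z ∧ cls z = j}.ncard = 3 := by
    have := hb (f q i) j
    rw [hfc q i hq hi, sporadicRow, if_neg hi.symm, if_neg hij.symm, if_neg hj] at this
    exact_mod_cast this
  have hsurj : ∀ z, cls z = j → ∃ p, cls p = b ∧ z = f p j := by
    intro z hz
    have := hb z b
    rw [hz, sporadicRow, if_neg hj.symm, if_neg hj.symm, if_pos rfl] at this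
    obtain ⟨p, hp, hp'⟩ := exists_unique_nbr (by omega : nbrCount G cls z b = 1)
    exact ⟨p, hp, ((hf p j hp hj).2 z hz).1 ((hp' p hp).2 rfl).symm⟩
  -- Of the three neighbours of `f q i` in class `j`, one is `f q j`; the other two are the
  -- out-neighbours of `q`.
  have hrem : 1 < ({z | G.Adj (f q i) z ∧ cls z = j} \ {f q j}).ncard := by
    have hmem : f q j ∈ {z | G.Adj (f q i) z ∧ cls z = j} :=
      ⟨hdiag i j q hi hj hij hq, hfc q j hq hj⟩
    rw [Set.ncard_sdiff_singleton_of_mem hmem, hdeg]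
    norm_num
  obtain ⟨z, ⟨⟨hz1, hz2⟩, hz3⟩, w, ⟨⟨hw1, hw2⟩, hw3⟩, hzw⟩ := Set.one_lt_ncard_iff_nontrivial.1 hrem
  obtain ⟨p, hp, rfl⟩ := hsurj z hz2
  obtain ⟨r, hr, rfl⟩ := hsurj w hw2
  have hpr : p ≠ r := fun h => hzw (by rw [h])
  have hqp : q ≠ p := fun h => hz3 (by rw [h]; rfl)
  have hqr : q ≠ r := fun h => hw3 (by rw [h]; rfl)
  by_cases hT : G.Adj (f p i) (f r j)
  · exact h4 r q p hr hq hp hqr hpr hqp hw1 hT hz1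
  · exact h4 p q r hp hq hr hqp hpr.symm hqr hz1 ((h3 p r hp hr hpr).2 hT) hw1

/-- Every quotient matrix arises from an involution of the set of classes. -/
theorem IsDDG.exists_involution {V : Type*} [Finite V] {G : SimpleGraph V} {n : ℕ} (hn : 2 ≤ n)
    (hn4 : n ≠ 4) {cls : V → Fin 4} (hG : IsDDG G (4 * n) (n + 2) (n - 2) 2 4 n cls) :
    ∃ σ : Fin 4 → Fin 4, (∀ i, σ (σ i) = i) ∧ (Odd n → ∀ i, σ i = i) ∧
      IsQuotientMatrix G cls (fun i j => if σ i = j then n - 1 else 1) := by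
  classical
  have := Fintype.ofFinite V
  obtain ⟨R, hR, hsymm, hsum, hsq⟩ := hG.exists_isQuotientMatrix (by omega) (by omega)
  have heven : Odd n → ∀ i, Even (R i i) := fun ho i =>
    even_nbrCount_of_odd ho (hG.card_class i) fun x hx => by
      have := hR x i
      rw [hx] at this
      exact this
  obtain ⟨N, rfl⟩ : ∃ N, n = N + 2 := ⟨n - 2, by omega⟩
  have hsum' : ∀ i, ∑ j, (R i j : ℤ) = N + 4 := by
    intro i
    exact_mod_cast hsum i
  -- Here `R² = N² I + 2nJ` and `R` has row sums `N + 4`, so `(R - J)² = N² I`.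
  rcases quotient_cases (N := N) (by omega) (by omega) (fun i j => (R i j : ℤ) - 1)
    (by intro i j; omega) (by intro i j; rw [hsymm])
    (by intro i; simp [hsum']) (by
      intro i j
      have h1 := hsq i j
      have e1 : ∀ a, ((R i a : ℤ) - 1) * ((R j a : ℤ) - 1) = R i a * R a j - R i a - R j a + 1 := by
        intro a; rw [hsymm a j]; ring
      simp only [e1, Finset.sum_add_distrib, Finset.sum_sub_distrib, h1, hsum']
      push_cast
      split_ifs <;> simp <;> ring)
    (by
      intro ho i
      have := heven (by rw [Nat.odd_iff]; omega) i
      rw [Nat.even_iff] at this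
      omega) with ⟨σ, hσ, hq⟩ | ⟨h3, b, hb⟩
  · have hRσ : ∀ i j, R i j = if σ i = j then N + 2 - 1 else 1 := by
      intro i j
      have := hq i j
      split_ifs at this ⊢ <;> omega
    refine ⟨σ, hσ, fun ho i => ?_, fun x j => (hR x j).trans (hRσ _ _)⟩
    by_contra hne
    have := heven ho i
    rw [hRσ, if_neg hne] at this
    exact absurd this (by decide)
  · obtain rfl : N = 3 := by omega
    refine (not_sporadic hG (b := b) fun x j => ?_).elim
    rw [← hb, nbrCount, hR x j]
    ring

/-! ### Special vertices and the square condition. -/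

/-- Every vertex `x` has a special vertex `nb x j` in every class `j`: its only non-neighbour in
the class `σ (cls x)`, and its only neighbour in each of the other classes. -/
structure IsSpecialSystem {V : Type*} (G : SimpleGraph V) (cls : V → Fin 4) (σ : Fin 4 → Fin 4)
    (nb : V → Fin 4 → V) : Prop where
  cls_nb : ∀ x j, cls (nb x j) = j
  adj_iff : ∀ x y, G.Adj x y ↔ (y = nb x (cls y) ↔ σ (cls x) ≠ cls y)
  nb_nb : ∀ x j, nb (nb x j) (cls x) = x
  square : ∀ x j k l, cls x ≠ j → k ≠ l → k ≠ σ (cls x) → l ≠ σ (cls x) → k ≠ σ j → l ≠ σ j →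
    (nb (nb x (σ (cls x))) j = nb (nb x k) j ∧ nb (nb x (σ j)) j = nb (nb x l) j) ∨
    (nb (nb x (σ (cls x))) j = nb (nb x l) j ∧ nb (nb x (σ j)) j = nb (nb x k) j)

-- The hypothesis says that each `y` occurs as often in `{A, B}` as in `{C, D}`; testing it at the
-- four points identifies the multisets.
open Classical in
theorem pair_eq_pair {V : Type*} {A B C D : V} (h : ∀ y, y = A ∨ y = B ∨ y = C ∨ y = D →
    (if y ≠ A then 1 else 0) + (if y ≠ B then 1 else 0) + (if y = C then 1 else 0) +
      (if y = D then 1 else 0) = 2) : (A = C ∧ B = D) ∨ (A = D ∧ B = C) := by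
  have hA := h A (by simp)
  have hB := h B (by simp)
  by_cases h1 : A = C
  · subst h1
    by_cases h4 : B = D
    · exact Or.inl ⟨rfl, h4⟩
    · rw [if_neg (by simp), if_pos rfl] at hA
      rw [if_neg (not_not.2 rfl : ¬ B ≠ B), if_neg h4] at hB
      split_ifs at hA hB <;> omega
  · by_cases h2 : A = D
    · subst h2
      rw [if_neg (by simp), if_pos rfl, if_neg h1] at hA
      rw [if_neg (not_not.2 rfl : ¬ B ≠ B)] at hB
      split_ifs at hA hB <;> first | omega | tauto
    · rw [if_neg (by simp), if_neg h1, if_neg h2] at hA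
      split_ifs at hA <;> omega

/-- For `x` and `y` in different classes `i` and `j`, the classes `σ i` and `σ j` each contain one
common neighbour unless the special vertices of `x` and `y` there agree; each of the other two
classes contains one exactly if they agree. The total `2` is then an equality of multisets of walk
ends, by `pair_eq_pair`. -/
theorem IsDDG.exists_isSpecialSystem {V : Type*} [Finite V] {G : SimpleGraph V} {n v k l1 : ℕ}
    (hn : 2 ≤ n) {cls : V → Fin 4} (hG : IsDDG G v k l1 2 4 n cls)
    {σ : Fin 4 → Fin 4} (hσ : ∀ i, σ (σ i) = i)
    (hQ : IsQuotientMatrix G cls (fun i j => if σ i = j then n - 1 else 1)) :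
    ∃ nb, IsSpecialSystem G cls σ nb := by
  classical
  have hex : ∀ x j, ∃ u, cls u = j ∧ ∀ z, cls z = j → (G.Adj x z ↔ (z = u ↔ σ (cls x) ≠ j)) := by
    intro x j
    have hx : nbrCount G cls x j = if σ (cls x) = j then n - 1 else 1 := hQ x j
    split_ifs at hx with h
    · obtain ⟨u, hu, hu'⟩ := exists_unique_nonnbr (by omega) (hG.card_class j) hx
      exact ⟨u, hu, fun z hz => by rw [hu' z hz]; tauto⟩
    · obtain ⟨u, hu, hu'⟩ := exists_unique_nbr hx
      exact ⟨u, hu, fun z hz => by rw [hu' z hz]; tauto⟩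
  choose nb hnb hadj using hex
  have hadj' : ∀ x y, G.Adj x y ↔ (y = nb x (cls y) ↔ σ (cls x) ≠ cls y) :=
    fun x y => hadj x (cls y) y rfl
  have hinv : ∀ x j, nb (nb x j) (cls x) = x := by
    intro x j
    have h1 := hadj' x (nb x j)
    have h2 := hadj' (nb x j) x
    rw [hnb] at h1 h2
    have h3 : σ (cls x) = j ↔ σ j = cls x :=
      ⟨fun h => by rw [← h, hσ], fun h => by rw [← h, hσ]⟩
    rw [G.adj_comm, h1] at h2
    tauto
  have hone : ∀ x a, σ (cls x) ≠ a → ∀ z, cls z = a → (G.Adj x z ↔ z = nb x a) := by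
    intro x a ha z hz
    rw [hadj x a z hz]
    tauto
  refine ⟨nb, hnb, hadj', hinv, ?_⟩
  intro x j k l hj hkl hk1 hl1 hk2 hl2
  have hij : σ (cls x) ≠ σ j := fun h => hj (by rw [← hσ (cls x), h, hσ])
  apply pair_eq_pair
  intro y hy
  have hy' : cls y = j := by rcases hy with rfl | rfl | rfl | rfl <;> rw [hnb]
  -- Agreement of special vertices in class `a` means that the two-step walk from `x` through class
  -- `a` into class `j` ends at `y`.
  have hcomm : ∀ a, nb x a = nb y a ↔ y = nb (nb x a) j := by
    intro a
    constructor
    · intro h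
      rw [h, ← hy', hinv]
    · intro h
      have := hinv (nb x a) j
      rw [hnb, ← h] at this
      exact this.symm
  have h1 : ∀ a, a ≠ σ (cls x) → a ≠ σ j →
      commonCount G cls x y a = if y = nb (nb x a) j then 1 else 0 := by
    intro a ha ha'
    rw [commonCount_of_unique_nbr (hnb x a) (hone x a (Ne.symm ha))]
    simp only [hone y a (by rw [hy']; exact ha'.symm) (nb x a) (hnb x a), hcomm]
  have h2 : commonCount G cls x y (σ (cls x)) = if y ≠ nb (nb x (σ (cls x))) j then 1 else 0 := by
    rw [commonCount_comm, commonCount_of_unique_nbr (hnb y _) (hone y _ (by rw [hy']; exact hij.symm)),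
      hadj x (σ (cls x)) _ (hnb _ _)]
    simp only [ne_eq, ← hcomm, not_true_eq_false, iff_false, eq_comm]
  have h3 : commonCount G cls x y (σ j) = if y ≠ nb (nb x (σ j)) j then 1 else 0 := by
    rw [commonCount_of_unique_nbr (hnb x _) (hone x _ hij),
      hadj y (σ j) _ (hnb _ _), hy']
    simp only [ne_eq, ← hcomm, not_true_eq_false, iff_false]
  rw [← h2, ← h3, ← h1 k hk1 hk2, ← h1 l hl1 hl2, ← hG.diff_class x y (by rw [hy']; exact hj),
    ← sum_commonCount G cls, fin_four_sum (σ (cls x)) (σ j) k l hij.symm hk1 hl1 hk2.symm hl2.symm hkl,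
    Finset.sum_insert (by simp [hij, hk1.symm, hl1.symm]),
    Finset.sum_insert (by simp [hk2.symm, hl2.symm]), Finset.sum_pair hkl]
  ring

/-! ### The first matrix: the lattice graph. -/

namespace IsSpecialSystem

variable {V : Type*} {G : SimpleGraph V} {cls : V → Fin 4} {σ : Fin 4 → Fin 4} {nb : V → Fin 4 → V}

theorem nb_cls_eq_self_iff (h : IsSpecialSystem G cls σ nb) (x : V) :
    nb x (cls x) = x ↔ σ (cls x) = cls x := by
  have := h.adj_iff x x
  rw [eq_comm (a := x)] at this
  have := G.loopless.irrefl x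
  tauto

theorem nb_injOn (h : IsSpecialSystem G cls σ nb) {x y : V} {j : Fin 4} (hxy : cls x = cls y)
    (hj : nb x j = nb y j) : x = y := by
  rw [← h.nb_nb x j, hj, hxy, h.nb_nb]

/-- Coordinates given by the class and by the representative in the class `b`. -/
def equivProd (h : IsSpecialSystem G cls σ nb) (b : Fin 4) : V ≃ Fin 4 × {x // cls x = b} where
  toFun x := (cls x, ⟨nb x b, h.cls_nb x b⟩)
  invFun p := nb p.2.1 p.1
  left_inv x := h.nb_nb x b
  right_inv p := by
    obtain ⟨i, x, rfl⟩ := p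
    refine Prod.ext (h.cls_nb _ _) (Subtype.ext ?_)
    exact h.nb_nb x i

/-- Each vertex is its own special vertex in its class, and the square condition makes `x` and `nb x
k` have the same special vertices. The special vertices of `x` are therefore the column of `x`,
named by its cell in class `b`. -/
theorem nonempty_iso_gridGraph (h : IsSpecialSystem G cls id nb) {b : Fin 4} {n : ℕ}
    (e : {x // cls x = b} ≃ Fin n) : Nonempty (G ≃g gridGraph 4 n) := by
  have hself : ∀ x, nb x (cls x) = x := fun x => (h.nb_cls_eq_self_iff x).2 rfl
  have htrans : ∀ x k j, nb (nb x k) j = nb x j := by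
    intro x k j
    have hself' : nb (nb x j) j = nb x j := by
      have := hself (nb x j)
      rwa [h.cls_nb] at this
    by_cases hkj : k = j
    · rw [hkj, hself']
    by_cases hki : k = cls x
    · rw [hki, hself]
    by_cases hji : cls x = j
    · rw [← hji, h.nb_nb, hself]
    obtain ⟨l, hlj, hli, hlk⟩ := fin_four_fourth j (cls x) k
    -- Both walks on the left of the square condition end at `nb x j`, hence so do both on the
    -- right.
    have := h.square x j k l hji hlk hki hli.symm hkj hlj
    simp only [id, hself, hself'] at this
    rcases this with ⟨h1, -⟩ | ⟨-, h1⟩ <;> exact h1.symm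
  refine ⟨⟨(h.equivProd b).trans ((Equiv.refl _).prodCongr e), ?_⟩⟩
  intro x y
  simp only [equivProd, gridGraph, Equiv.trans_apply, Equiv.coe_fn_mk, Equiv.prodCongr_apply,
    Equiv.coe_refl, Prod.map, id, ne_eq, Prod.mk.injEq, e.injective.eq_iff, Subtype.mk.injEq,
    h.adj_iff]
  by_cases hc : cls x = cls y
  · have h1 : nb x b = nb y b ↔ y = nb x (cls y) := by
      rw [← hc, hself]
      exact ⟨fun h' => (h.nb_injOn hc h').symm, fun h' => by rw [h']⟩
    simp [hc, h1]
  · have h1 : nb x b = nb y b ↔ y = nb x (cls y) := by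
      constructor
      · intro h'
        rw [← htrans x b, h', htrans, hself]
      · intro h'
        rw [h', htrans]
    simp [hc, h1]

end IsSpecialSystem

/-! ### The second matrix: the switched lattice graph. -/

/-- All fixed-point-free involutions of a finite set have the same cycle type, hence are conjugate;
reversal is one of them because `n` is even. -/
theorem exists_equiv_fin_rev {α : Type*} [Finite α] {n : ℕ} (hn : Even n) (hc : Nat.card α = n)
    (μ : α → α) (h2 : ∀ a, μ (μ a) = a) (hne : ∀ a, μ a ≠ a) :
    ∃ e : α ≃ Fin n, ∀ a, e (μ a) = (e a).rev := by
  classical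
  subst hc
  let e₁ := Finite.equivFin α
  let ρ : Equiv.Perm (Fin (Nat.card α)) := (e₁.symm.trans (Function.Involutive.toPerm μ h2)).trans e₁
  have hρ : ∀ i, ρ i = e₁ (μ (e₁.symm i)) := fun i => rfl
  have hcyc : ∀ τ : Equiv.Perm (Fin (Nat.card α)), (∀ i, τ (τ i) = i) → (∀ i, τ i ≠ i) →
      τ.cycleType = Multiset.replicate (Nat.card α / 2) 2 := by
    intro τ h1 h3
    have hτ : τ ^ 2 = 1 := by
      ext i
      simp [sq, h1]
    have hsupp : τ.support = Finset.univ := by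
      ext i
      simp [h3]
    have hrep := Equiv.Perm.cycleType_of_pow_prime_eq_one hτ
    have hsum := τ.sum_cycleType
    rw [hrep, hsupp, Multiset.sum_replicate, smul_eq_mul, Finset.card_univ, Fintype.card_fin] at hsum
    rwa [show Nat.card α / 2 = τ.cycleType.card by omega]
  have hconj : IsConj ρ Fin.revPerm := by
    rw [Equiv.Perm.isConj_iff_cycleType_eq, hcyc ρ, hcyc Fin.revPerm]
    · simp
    · intro i h
      obtain ⟨k, hk⟩ := hn
      have := congrArg Fin.val h
      simp only [Fin.revPerm_apply, Fin.val_rev] at this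
      omega
    · simp [hρ, h2]
    · intro i h
      rw [hρ, ← Equiv.eq_symm_apply] at h
      exact hne _ h
  obtain ⟨c, hc⟩ := isConj_iff.1 hconj
  refine ⟨e₁.trans c, fun a => ?_⟩
  have := congrArg (fun τ : Equiv.Perm _ => τ (c (e₁ a))) hc
  simpa [hρ] using this

/-- The special vertex in class 2 is used as a column label. Passing to a special vertex keeps the
label, except within the classes 0 and 1, where it changes by a fixed-point-free involution.
Numbering the columns so that this involution is reversal turns it into the central symmetry. -/
theorem IsSpecialSystem.nonempty_iso_gPrime {V : Type*} [Finite V] {G : SimpleGraph V} {cls : V → Fin 4}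
    {nb : V → Fin 4 → V} (h : IsSpecialSystem G cls (Equiv.swap 0 1) nb) {n : ℕ} (hn : Even n)
    (hc : {x | cls x = 2}.ncard = n) : Nonempty (G ≃g gPrime n) := by
  have s0 : Equiv.swap (0 : Fin 4) 1 0 = 1 := rfl
  have s1 : Equiv.swap (0 : Fin 4) 1 1 = 0 := rfl
  have s2 : Equiv.swap (0 : Fin 4) 1 2 = 2 := rfl
  have s3 : Equiv.swap (0 : Fin 4) 1 3 = 3 := rfl
  have self2 : ∀ x, cls x = 2 → nb x 2 = x := fun x hx => by
    have := (h.nb_cls_eq_self_iff x).2 (by rw [hx, s2])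
    rwa [hx] at this
  have self3 : ∀ x, cls x = 3 → nb x 3 = x := fun x hx => by
    have := (h.nb_cls_eq_self_iff x).2 (by rw [hx, s3])
    rwa [hx] at this
  have ne0 : ∀ x, cls x = 0 → nb x 0 ≠ x := fun x hx h' => by
    have := (h.nb_cls_eq_self_iff x).1 (by rw [hx, h'])
    rw [hx, s0] at this
    exact absurd this (by decide)
  have back : ∀ x i j, cls x = i → nb (nb x j) i = x := fun x i j hx => hx ▸ h.nb_nb x j
  have h23 : ∀ x, cls x = 2 → nb (nb x 0) 3 = nb x 3 ∧ nb (nb x 1) 3 = nb x 3 := by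
    intro x hx
    have := h.square x 3 0 1 (by rw [hx]; decide) (by decide) (by rw [hx]; decide)
      (by rw [hx]; decide) (by decide) (by decide)
    rw [hx, s2, s3, self2 x hx, self3 _ (h.cls_nb x 3)] at this
    rcases this with ⟨a, b⟩ | ⟨a, b⟩
    · exact ⟨a.symm, b.symm⟩
    · exact ⟨b.symm, a.symm⟩
  have h32 : ∀ x, cls x = 3 → nb (nb x 0) 2 = nb x 2 ∧ nb (nb x 1) 2 = nb x 2 := by
    intro x hx
    have := h.square x 2 0 1 (by rw [hx]; decide) (by decide) (by rw [hx]; decide)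
      (by rw [hx]; decide) (by decide) (by decide)
    rw [hx, s2, s3, self3 x hx, self2 _ (h.cls_nb x 2)] at this
    rcases this with ⟨a, b⟩ | ⟨a, b⟩
    · exact ⟨a.symm, b.symm⟩
    · exact ⟨b.symm, a.symm⟩
  have h332 : ∀ x, cls x = 0 ∨ cls x = 1 → nb (nb x 3) 2 = nb x 2 := by
    intro x hx
    have hp := h.cls_nb x 2
    have h3 : nb x 3 = nb (nb x 2) 3 := by
      rcases hx with hx | hx
      · rw [← (h23 _ hp).1, back x 0 2 hx]
      · rw [← (h23 _ hp).2, back x 1 2 hx]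
    rw [h3, back _ 2 3 hp]
  -- One walk on each side of the square condition ends at `nb x 2`, so the other two end together.
  have h012 : ∀ x, cls x = 0 ∨ cls x = 1 → nb (nb x 1) 2 = nb (nb x 0) 2 := by
    intro x hx
    have e2 := self2 _ (h.cls_nb x 2)
    have e3 := h332 x hx
    rcases hx with hx | hx
    · have := h.square x 2 0 3 (by rw [hx]; decide) (by decide) (by rw [hx]; decide)
        (by rw [hx]; decide) (by decide) (by decide)
      rw [hx, s0, s2, e2, e3] at this
      rcases this with ⟨a, -⟩ | ⟨a, b⟩
      · exact a
      · rw [a, b]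
    · have := h.square x 2 1 3 (by rw [hx]; decide) (by decide) (by rw [hx]; decide)
        (by rw [hx]; decide) (by decide) (by decide)
      rw [hx, s1, s2, e2, e3] at this
      rcases this with ⟨a, -⟩ | ⟨a, b⟩
      · exact a.symm
      · rw [a, b]
  -- The involution is the special-vertex map of class 0, carried over to class 2; a fixed point
  -- would be a vertex of class 0 special to itself.
  let μ : {x // cls x = 2} → {x // cls x = 2} := fun p => ⟨nb (nb (nb p.1 0) 0) 2, h.cls_nb _ _⟩
  have hμ2 : ∀ p, μ (μ p) = p := by
    rintro ⟨p, hp⟩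
    apply Subtype.ext
    simp only [μ]
    rw [back _ 0 2 (h.cls_nb _ _), back _ 0 0 (h.cls_nb _ _), back _ 2 0 hp]
  have hμne : ∀ p, μ p ≠ p := by
    rintro ⟨p, hp⟩ h'
    have := congrArg (fun q => nb q.1 0) h'
    simp only [μ] at this
    rw [back _ 0 2 (h.cls_nb _ _)] at this
    exact ne0 _ (h.cls_nb _ _) this
  obtain ⟨e, he⟩ := exists_equiv_fin_rev hn
    (by rw [← hc, ← Nat.card_coe_set_eq]; rfl) μ hμ2 hμne
  let lab : V → {x // cls x = 2} := fun x => ⟨nb x 2, h.cls_nb x 2⟩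
  have hlab0 : ∀ x, cls x = 0 → lab (nb x 0) = μ (lab x) := by
    intro x hx
    apply Subtype.ext
    simp only [lab, μ]
    rw [back x 0 2 hx]
  have hlab1 : ∀ x, cls x = 1 → lab (nb x 0) = μ (lab x) := by
    intro x hx
    have e1 := hlab0 (nb x 0) (h.cls_nb x 0)
    have e2 : lab (nb (nb x 0) 0) = lab x := by
      apply Subtype.ext
      simp only [lab]
      rw [← h012 _ (Or.inl (h.cls_nb x 0)), back x 1 0 hx]
    rw [← e2, e1, hμ2]
  have hlab : ∀ x j, lab (nb x j) =
      if (cls x = 0 ∨ cls x = 1) ∧ (j = 0 ∨ j = 1) then μ (lab x) else lab x := by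
    intro x j
    split_ifs with hxj
    · obtain ⟨hx, rfl | rfl⟩ := hxj
      · exact hx.elim (hlab0 x) (hlab1 x)
      · have : lab (nb x 1) = lab (nb x 0) := Subtype.ext (h012 x hx)
        rw [this]
        exact hx.elim (hlab0 x) (hlab1 x)
    · apply Subtype.ext
      simp only [lab]
      have e2 := self2 _ (h.cls_nb x 2)
      obtain hx | hx : (cls x = 0 ∨ cls x = 1) ∨ (cls x = 2 ∨ cls x = 3) := by
        generalize cls x = i; revert i; decide
      · obtain rfl | rfl : j = 2 ∨ j = 3 := by
          have : ¬ (j = 0 ∨ j = 1) := fun hj => hxj ⟨hx, hj⟩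
          clear hxj
          revert j; decide
        · exact e2
        · exact h332 x hx
      · rcases hx with hx | hx
        · rw [back x 2 j hx, self2 x hx]
        · obtain rfl | rfl | rfl | rfl : j = 0 ∨ j = 1 ∨ j = 2 ∨ j = 3 := by
            clear hxj; revert j; decide
          · exact (h32 x hx).1
          · exact (h32 x hx).2
          · exact e2
          · rw [self3 x hx]
  have hadj : ∀ x y, G.Adj x y ↔ ((e (lab y) = if (cls x = 0 ∨ cls x = 1) ∧ (cls y = 0 ∨ cls y = 1)
      then (e (lab x)).rev else e (lab x)) ↔ Equiv.swap 0 1 (cls x) ≠ cls y) := by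
    intro x y
    rw [h.adj_iff, ← he, ← apply_ite e, ← hlab, e.injective.eq_iff]
    have : y = nb x (cls y) ↔ lab y = lab (nb x (cls y)) := by
      refine ⟨fun h' => by rw [← h'], fun h' => ?_⟩
      exact h.nb_injOn (h.cls_nb _ _).symm (congrArg Subtype.val h')
    rw [this]
  refine ⟨⟨(h.equivProd 2).trans ((Equiv.refl _).prodCongr e), ?_⟩⟩
  intro x y
  rw [hadj]
  change (gPrime n).Adj (cls x, e (lab x)) (cls y, e (lab y)) ↔ _
  rw [gPrime, gdss_adj (isSeidelAut_centralSymm hn)]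
  generalize e (lab x) = p
  generalize e (lab y) = q
  generalize cls x = i
  generalize cls y = j
  simp only [topRows, gridGraph, centralSymm, Set.mem_ofPred_eq, ne_eq, Prod.mk.injEq]
  fin_cases i <;> fin_cases j <;> simp [eq_comm, s2, s3]

/-! ### The third matrix: square systems and twins. -/

/-- The two pairs of walks of length two from `x` (of class `i`) into the class `j` that share their
ends when the neighbours in the classes `i`, `k` and those in the classes `j`, `l` are paired. -/
def WalksMeet {V : Type*} (nb : V → Fin 4 → V) (x : V) (i j k l : Fin 4) : Prop :=
  nb (nb x i) j = nb (nb x k) j ∧ nb (nb x j) j = nb (nb x l) j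

/-- A graph with four classes, given by the unique neighbour `nb x j` of `x` in the class `j`, such
that vertices of different classes `i`, `j` have as many common neighbours in the classes `i` and
`j` as in the other two classes. -/
structure IsSquareSystem {V : Type*} (cls : V → Fin 4) (nb : V → Fin 4 → V) : Prop where
  cls_nb : ∀ x j, cls (nb x j) = j
  nb_nb : ∀ x j, nb (nb x j) (cls x) = x
  nb_ne : ∀ x, nb x (cls x) ≠ x
  square : ∀ x j k l, cls x ≠ j → cls x ≠ k → cls x ≠ l → j ≠ k → j ≠ l → k ≠ l →
    WalksMeet nb x (cls x) j k l ∨ WalksMeet nb x (cls x) j l k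

/-- The set `{mate i, mate j}` is either `{i, j}` or its complement. The split of the four classes
in the square condition is therefore always `{i, j}` against the rest, and the two sides play
symmetric roles. -/
theorem IsSpecialSystem.isSquareSystem {V : Type*} {G : SimpleGraph V} {cls : V → Fin 4}
    {nb : V → Fin 4 → V} (h : IsSpecialSystem G cls mate nb) : IsSquareSystem cls nb where
  cls_nb := h.cls_nb
  nb_nb := h.nb_nb
  nb_ne x hx := mate_ne _ ((h.nb_cls_eq_self_iff x).1 hx)
  square x j k l hj hk hl hjk hjl hkl := by
    have hcase : ∀ i j k l : Fin 4, i ≠ j → i ≠ k → i ≠ l → j ≠ k → j ≠ l → k ≠ l →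
        (mate i = j ∧ mate j = i) ∨ (mate i = k ∧ mate j = l) ∨ (mate i = l ∧ mate j = k) := by
      decide
    unfold WalksMeet
    rcases hcase _ j k l hj hk hl hjk hjl hkl with ⟨h1, h2⟩ | ⟨h1, h2⟩ | ⟨h1, h2⟩
    · have := h.square x j k l hj hkl (by rw [h1]; exact hjk.symm) (by rw [h1]; exact hjl.symm)
        (by rw [h2]; exact hk.symm) (by rw [h2]; exact hl.symm)
      rw [h1, h2] at this
      tauto
    · have := h.square x j (cls x) j hj hj (by rw [h1]; exact hk) (by rw [h1]; exact hjk)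
        (by rw [h2]; exact hl) (by rw [h2]; exact hjl)
      rw [h1, h2] at this
      rcases this with ⟨a, b⟩ | ⟨a, b⟩
      · exact Or.inl ⟨a.symm, b.symm⟩
      · exact Or.inr ⟨b.symm, a.symm⟩
    · have := h.square x j (cls x) j hj hj (by rw [h1]; exact hl) (by rw [h1]; exact hjl)
        (by rw [h2]; exact hk) (by rw [h2]; exact hjk)
      rw [h1, h2] at this
      rcases this with ⟨a, b⟩ | ⟨a, b⟩
      · exact Or.inr ⟨a.symm, b.symm⟩
      · exact Or.inl ⟨b.symm, a.symm⟩

/-- Vertices of different classes with the same neighbours. -/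
def AreTwins {V : Type*} (cls : V → Fin 4) (nb : V → Fin 4 → V) (x y : V) : Prop :=
  cls x ≠ cls y ∧ ∀ a, nb x a = nb y a

namespace IsSquareSystem

variable {V : Type*} {cls : V → Fin 4} {nb : V → Fin 4 → V}

theorem nb_nb_of_cls (h : IsSquareSystem cls nb) {x : V} {i : Fin 4} (hx : cls x = i) (j : Fin 4) :
    nb (nb x j) i = x :=
  hx ▸ h.nb_nb x j

theorem perm (h : IsSquareSystem cls nb) (π : Equiv.Perm (Fin 4)) :
    IsSquareSystem (π.symm ∘ cls) (fun x j => nb x (π j)) where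
  cls_nb x j := by simp [h.cls_nb]
  nb_nb x j := by simp [h.nb_nb]
  nb_ne x := by simp [h.nb_ne]
  square x j k l hj hk hl hjk hjl hkl := by
    have := h.square x (π j) (π k) (π l)
    simp only [Function.comp_apply, ne_eq, Equiv.symm_apply_eq, WalksMeet, Equiv.apply_symm_apply,
      π.injective.eq_iff] at *
    exact this hj hk hl hjk hjl hkl

/-- The graph described by a square system. -/
def graph (h : IsSquareSystem cls nb) : SimpleGraph V where
  Adj x y := y = nb x (cls y)
  symm := ⟨fun x y hxy => by
    have := h.nb_nb x (cls y)
    rw [← hxy] at this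
    exact this.symm⟩
  loopless := ⟨fun x hx => h.nb_ne x hx.symm⟩

theorem graph_adj (h : IsSquareSystem cls nb) {x y : V} : h.graph.Adj x y ↔ y = nb x (cls y) :=
  Iff.rfl

theorem areTwins_of_common_end (h : IsSquareSystem cls nb) {x : V} {j : Fin 4} {y : V}
    (hj : cls x ≠ j) (hy : ∀ a, nb (nb x a) j = y) : AreTwins cls nb x y := by
  constructor
  · rw [← hy j, h.cls_nb]
    exact hj
  · intro a
    rw [← hy a]
    exact (h.nb_nb_of_cls (h.cls_nb x a) j).symm

/-- The twins `x` and `y` have the same four walk ends in class `k`, but their own classes exchange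
roles in the square condition. Either one of the two conditions gives the desired pairing, or both
give the other one, and then all four ends coincide. -/
theorem areTwins_nb (h : IsSquareSystem cls nb) {x y : V} (hxy : AreTwins cls nb x y) {k l : Fin 4}
    (hik : cls x ≠ k) (hil : cls x ≠ l) (hjk : cls y ≠ k) (hjl : cls y ≠ l) (hkl : k ≠ l) :
    AreTwins cls nb (nb x (cls x)) (nb x (cls y)) ∧ AreTwins cls nb (nb x k) (nb x l) := by
  obtain ⟨hij, ht⟩ := hxy
  have key : ∀ k l, cls x ≠ k → cls x ≠ l → cls y ≠ k → cls y ≠ l → k ≠ l →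
      nb (nb x (cls x)) k = nb (nb x (cls y)) k ∧ nb (nb x k) k = nb (nb x l) k := by
    intro k l hik hil hjk hjl hkl
    have h1 := h.square x k (cls y) l hik hij hil hjk.symm hkl hjl
    have h2 := h.square y k (cls x) l hjk hij.symm hjl hik.symm hkl hil
    simp only [WalksMeet, ← ht] at h1 h2
    rcases h1 with ⟨a, b⟩ | ⟨a, b⟩
    · exact ⟨a, b⟩
    · rcases h2 with ⟨c, d⟩ | ⟨c, d⟩
      · exact ⟨c.symm, d⟩
      · exact ⟨by rw [a, ← c], by rw [b, c]⟩
  have hx : ∀ a, nb (nb x a) (cls x) = x := h.nb_nb x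
  have hy : ∀ a, nb (nb x a) (cls y) = y := fun a => by rw [ht, h.nb_nb]
  have hcov : ∀ a, a = cls x ∨ a = cls y ∨ a = k ∨ a = l := by
    have : ∀ i j k l a : Fin 4, i ≠ j → i ≠ k → i ≠ l → j ≠ k → j ≠ l → k ≠ l →
      a = i ∨ a = j ∨ a = k ∨ a = l := by decide
    exact fun a => this _ _ k l a hij hik hil hjk hjl hkl
  refine ⟨⟨by simpa [h.cls_nb] using hij, fun a => ?_⟩, ⟨by simpa [h.cls_nb] using hkl, fun a => ?_⟩⟩
  · rcases hcov a with rfl | rfl | rfl | rfl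
    · rw [hx, hx]
    · rw [hy, hy]
    · exact (key _ l hik hil hjk hjl hkl).1
    · exact (key _ k hil hik hjl hjk hkl.symm).1
  · rcases hcov a with rfl | rfl | rfl | rfl
    · rw [hx, hx]
    · rw [hy, hy]
    · exact (key _ l hik hil hjk hjl hkl).2
    · exact (key _ k hil hik hjl hjk hkl.symm).2.symm

end IsSquareSystem

theorem AreTwins.symm {V : Type*} {cls : V → Fin 4} {nb : V → Fin 4 → V} {x y : V}
    (h : AreTwins cls nb x y) : AreTwins cls nb y x :=
  ⟨h.1.symm, fun a => (h.2 a).symm⟩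

namespace IsSquareSystem

variable {V : Type*} {cls : V → Fin 4} {nb : V → Fin 4 → V}

/-- Being a twin spreads to the neighbours. -/
theorem exists_areTwins_nb (h : IsSquareSystem cls nb) {x : V} (hx : ∃ y, AreTwins cls nb x y)
    (m : Fin 4) : ∃ y, AreTwins cls nb (nb x m) y := by
  obtain ⟨y, hxy⟩ := hx
  have : ∀ i j m : Fin 4, i ≠ j → ∃ k l, i ≠ k ∧ i ≠ l ∧ j ≠ k ∧ j ≠ l ∧ k ≠ l ∧
      (m = i ∨ m = j ∨ m = k) := by decide
  obtain ⟨k, l, h1, h2, h3, h4, h5, hm⟩ := this _ _ m hxy.1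
  have ht := h.areTwins_nb hxy h1 h2 h3 h4 h5
  rcases hm with rfl | rfl | rfl
  · exact ⟨_, ht.1⟩
  · exact ⟨_, ht.1.symm⟩
  · exact ⟨_, ht.2⟩

theorem exists_areTwins_nb_iff (h : IsSquareSystem cls nb) {x : V} (m : Fin 4) :
    (∃ y, AreTwins cls nb (nb x m) y) ↔ ∃ y, AreTwins cls nb x y := by
  refine ⟨fun hx => ?_, fun hx => h.exists_areTwins_nb hx m⟩
  have := h.exists_areTwins_nb hx (cls x)
  rwa [h.nb_nb] at this

end IsSquareSystem

/-! ### The building blocks as targets -/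

theorem fourCube_adj_iff (x y : Fin 4 → Bool) : fourCube.Adj x y ↔ ∃ i, y = flipBit x i := by
  change hammingDist x y = 1 ↔ _
  revert x y
  decide

theorem cycleGraph_adj_iff_val {N : ℕ} (hN : 3 ≤ N) (u v : Fin N) :
    (SimpleGraph.cycleGraph N).Adj u v ↔ v.val = u.val + 1 ∨ u.val = v.val + 1 ∨
      (u.val = 0 ∧ v.val = N - 1) ∨ (v.val = 0 ∧ u.val = N - 1) := by
  rw [SimpleGraph.cycleGraph_adj']
  have hu := u.2
  have hv := v.2
  rcases lt_trichotomy u v with h | rfl | h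
  · rw [Fin.sub_val_of_le h.le, Fin.coe_sub_iff_lt.2 h]
    rw [Fin.lt_def] at h
    omega
  · have : NeZero N := ⟨by omega⟩
    rw [sub_self, Fin.val_zero]
    omega
  · rw [Fin.sub_val_of_le h.le, Fin.coe_sub_iff_lt.2 h]
    rw [Fin.lt_def] at h
    omega

/-- The neighbours of `p` have residues `p + 1` and `p - 1` modulo 4, also across the end of the
cycle since its length is a multiple of 4, and exactly one of these residues is below 2. -/
theorem cycleGraph_exists_adj_mod {r : ℕ} (p : Fin (4 * r)) :
    (∃ q, (SimpleGraph.cycleGraph (4 * r)).Adj p q ∧ q.val % 4 < 2) ∧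
      ∃ q, (SimpleGraph.cycleGraph (4 * r)).Adj p q ∧ ¬ q.val % 4 < 2 := by
  have hp := p.2
  obtain ⟨next, hnext, hn⟩ : ∃ q : Fin (4 * r), (SimpleGraph.cycleGraph (4 * r)).Adj p q ∧
      q.val % 4 = (p.val + 1) % 4 := by
    by_cases h : p.val + 1 = 4 * r
    · refine ⟨⟨0, by omega⟩, ?_, ?_⟩
      · rw [cycleGraph_adj_iff_val (by omega)]
        exact Or.inr (Or.inr (Or.inr ⟨rfl, by omega⟩))
      · change 0 % 4 = _
        omega
    · exact ⟨⟨p.val + 1, by omega⟩, (cycleGraph_adj_iff_val (by omega) _ _).2 (Or.inl rfl), rfl⟩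
  obtain ⟨prev, hprev, hv⟩ : ∃ q : Fin (4 * r), (SimpleGraph.cycleGraph (4 * r)).Adj p q ∧
      q.val % 4 = (p.val + 3) % 4 := by
    by_cases h : p.val = 0
    · refine ⟨⟨4 * r - 1, by omega⟩, ?_, ?_⟩
      · rw [cycleGraph_adj_iff_val (by omega)]
        exact Or.inr (Or.inr (Or.inl ⟨h, rfl⟩))
      · change (4 * r - 1) % 4 = _
        omega
    · refine ⟨⟨p.val - 1, by omega⟩, ?_, ?_⟩
      · rw [cycleGraph_adj_iff_val (by omega)]
        refine Or.inr (Or.inl ?_)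
        change p.val = p.val - 1 + 1
        omega
      · change (p.val - 1) % 4 = _
        omega
  by_cases h : next.val % 4 < 2
  · exact ⟨⟨next, hnext, h⟩, ⟨prev, hprev, by omega⟩⟩
  · exact ⟨⟨prev, hprev, by omega⟩, ⟨next, hnext, h⟩⟩

theorem Piece.exists_adj_label (P : Piece) (a : P.Vertex) (c : Fin 4) :
    ∃ b, P.graph.Adj a b ∧ P.label b = c := by
  cases P with
  | cycle r hr τ =>
    obtain ⟨p, b⟩ := a
    obtain ⟨⟨q, hq, hq'⟩, ⟨q', hp, hp'⟩⟩ := cycleGraph_exists_adj_mod p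
    obtain ⟨t, rfl⟩ := τ.surjective c
    obtain rfl | rfl | rfl | rfl : t = 0 ∨ t = 1 ∨ t = 2 ∨ t = 3 := by revert t; decide
    · exact ⟨(q, 0), Or.inl hq, by simp [Piece.label, hq']⟩
    · exact ⟨(q, 1), Or.inl hq, by simp [Piece.label, hq']⟩
    · exact ⟨(q', 0), Or.inl hp, by simp [Piece.label, hp']⟩
    · exact ⟨(q', 1), Or.inl hp, by simp [Piece.label, hp']⟩
  | cube f hf =>
    obtain ⟨y, hy⟩ := Set.ncard_eq_one.1 (hf.equitable a c)
    have : y ∈ ({y} : Set _) := rfl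
    rw [← hy] at this
    exact ⟨y, this.1, this.2⟩

theorem Piece.preconnected (P : Piece) : P.graph.Preconnected := by
  cases P with
  | cycle r hr τ =>
    rintro ⟨p, b⟩ ⟨q, c⟩
    let φ : SimpleGraph.cycleGraph (4 * r) →g (Piece.cycle r hr τ).graph :=
      ⟨fun p => (p, b), fun h => Or.inl h⟩
    refine ((SimpleGraph.cycleGraph_preconnected p q).map φ).trans ?_
    obtain ⟨⟨q', hq, -⟩, -⟩ := cycleGraph_exists_adj_mod q
    have h1 : (Piece.cycle r hr τ).graph.Adj (q, b) (q', b) := Or.inl hq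
    have h2 : (Piece.cycle r hr τ).graph.Adj (q', b) (q, c) := Or.inl hq.symm
    exact h1.reachable.trans h2.reachable
  | cube f hf =>
    have hstep : ∀ (x : Fin 4 → Bool) i, fourCube.Reachable x (Function.update x i false) := by
      intro x i
      by_cases hx : x i = false
      · rw [← hx, Function.update_eq_self]
      · refine ((fourCube_adj_iff _ _).2 ⟨i, ?_⟩).reachable
        simp [flipBit, hx]
    have hzero : ∀ x : Fin 4 → Bool, fourCube.Reachable x fun _ => false := by
      intro x
      have h := (((hstep x 0).trans (hstep _ 1)).trans (hstep _ 2)).trans (hstep _ 3)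
      convert h using 1
      funext i
      fin_cases i <;> simp [Function.update]
    exact fun x y => (hzero x).trans (hzero y).symm

namespace IsSquareSystem

variable {V : Type*} {cls : V → Fin 4} {nb : V → Fin 4 → V}

/-- A label-preserving injective homomorphism of a building block is an isomorphism onto
a connected component. -/
theorem adj_iff_and_range (h : IsSquareSystem cls nb) (P : Piece) (e : P.Vertex → V)
    (hinj : Function.Injective e) (hcls : ∀ a, cls (e a) = P.label a)
    (hadj : ∀ a b, P.graph.Adj a b → h.graph.Adj (e a) (e b)) :
    (∀ a b, h.graph.Adj (e a) (e b) ↔ P.graph.Adj a b) ∧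
      ∀ a y, h.graph.Reachable (e a) y ↔ y ∈ Set.range e := by
  -- A square system has only one neighbour per class, and the block already supplies one for every
  -- label; so no edge leaves the image.
  have hnb : ∀ a y, h.graph.Adj (e a) y → ∃ b, P.graph.Adj a b ∧ e b = y := by
    intro a y hy
    obtain ⟨b, hab, hb⟩ := P.exists_adj_label a (cls y)
    refine ⟨b, hab, ?_⟩
    have h1 := hadj a b hab
    rw [graph_adj] at h1 hy
    rw [h1, hcls, hb, ← hy]
  refine ⟨fun a b => ⟨fun hab => ?_, hadj a b⟩, fun a y => ⟨?_, ?_⟩⟩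
  · obtain ⟨b', hb', he⟩ := hnb a _ hab
    rwa [← hinj he]
  · rintro ⟨w⟩
    have : ∀ u v, h.graph.Walk u v → u ∈ Set.range e → v ∈ Set.range e := by
      intro u v w
      induction w with
      | nil => exact id
      | cons huv _ ih =>
        rintro ⟨a, rfl⟩
        obtain ⟨b, -, hb⟩ := hnb a _ huv
        exact ih ⟨b, hb⟩
    exact this _ _ w ⟨a, rfl⟩
  · rintro ⟨b, rfl⟩
    let φ : P.graph →g h.graph := ⟨e, fun {a b} => hadj a b⟩
    exact (P.preconnected a b).map φ

end IsSquareSystem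

/-! ### Components with twins. -/

/-- Two involutions without fixed points generate a dihedral group that acts semiregularly: the
reflections have no fixed points. -/
theorem iterate_ne_of_involutive {V : Type*} {α β : V → V} (hα : Function.Involutive α)
    (hβ : Function.Involutive β) (hα' : ∀ x, α x ≠ x) (x : V) (s t : ℕ) :
    (fun z => β (α (β (α z))))^[s] x ≠ α ((fun z => β (α (β (α z))))^[t] x) := by
  set F : V → V := fun z => β (α (β (α z))) with hF
  have hinj : Function.Injective F :=
    hβ.injective.comp (hα.injective.comp (hβ.injective.comp hα.injective))
  -- Conjugation by the reflection `α` inverts the rotation `F`.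
  have hconj : ∀ t z, F^[t] (α (F^[t] z)) = α z := by
    intro t
    induction t with
    | zero => intro z; rfl
    | succ t ih =>
      intro z
      have h1 : F^[t + 1] z = F (F^[t] z) := Function.iterate_succ_apply' F t z
      have h2 : ∀ w, F (α (F w)) = α w := by
        intro w
        simp only [hF, hα _, hβ _]
      rw [Function.iterate_succ_apply, h1, h2, ih]
  intro hst
  have h1 : F^[t + s] x = α x := by
    rw [Function.iterate_add_apply, hst, hconj]
  -- Halving the exponent in `F^(t+s) x = α x` yields a fixed point of `α`: `F^m x` in the even
  -- case, `β (α (F^m x))` in the odd case.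
  obtain ⟨m, hm | hm⟩ := Nat.even_or_odd' (t + s)
  · rw [hm, two_mul, Function.iterate_add_apply, ← hconj m x] at h1
    exact hα' _ ((hinj.iterate m) h1).symm
  · rw [hm, show 2 * m + 1 = m + (1 + m) by ring, Function.iterate_add_apply, ← hconj m x] at h1
    have h2 := (hinj.iterate m) h1
    rw [Function.iterate_add_apply] at h2
    generalize F^[m] x = z at h2
    have h3 : β (α (β (α z))) = α z := h2
    have h4 := congrArg β h3
    rw [hβ] at h4
    exact hα' _ h4

/-- The pairing of the classes 0, 1 with the classes 2, 3. -/
def shiftClass : Fin 4 → Fin 4 := ![2, 3, 0, 1]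

theorem shiftClass_shiftClass (i : Fin 4) : shiftClass (shiftClass i) = i := by
  revert i; decide

theorem mate_mate (i : Fin 4) : mate (mate i) = i := by
  revert i; decide

namespace IsSquareSystem

variable {V : Type*} {cls : V → Fin 4} {nb : V → Fin 4 → V}

/-- The candidate for a twin of `x` in the class paired with the class of `x`. -/
def twin (cls : V → Fin 4) (nb : V → Fin 4 → V) (x : V) : V :=
  nb (nb x (cls x)) (mate (cls x))

theorem areTwins_twin_iff (h : IsSquareSystem cls nb) {x : V} :
    AreTwins cls nb x (twin cls nb x) ↔ ∃ y, cls y = mate (cls x) ∧ AreTwins cls nb x y := by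
  constructor
  · exact fun hx => ⟨_, h.cls_nb _ _, hx⟩
  · rintro ⟨y, hy, hxy⟩
    have : twin cls nb x = y := by
      rw [twin, hxy.2, ← hy, h.nb_nb]
    rwa [this]

theorem twin_eq (h : IsSquareSystem cls nb) {x : V} (hx : AreTwins cls nb x (twin cls nb x))
    (a : Fin 4) : twin cls nb x = nb (nb x a) (mate (cls x)) := by
  have h1 := h.nb_nb (twin cls nb x) a
  rw [← hx.2] at h1
  rw [← h1, twin, h.cls_nb]

/-- The pairing of classes by `mate` persists along edges: the twin of `nb x m` is `nb x (mate m)`.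
-/
theorem areTwins_twin_nb (h : IsSquareSystem cls nb) {x : V}
    (hx : AreTwins cls nb x (twin cls nb x)) (m : Fin 4) :
    AreTwins cls nb (nb x m) (twin cls nb (nb x m)) := by
  rw [areTwins_twin_iff h]
  refine ⟨nb x (mate m), by simp [h.cls_nb], ?_⟩
  have hc : cls (twin cls nb x) = mate (cls x) := h.cls_nb _ _
  have key : ∀ i m : Fin 4, m = i ∨ m = mate i ∨
      (i ≠ m ∧ i ≠ mate m ∧ mate i ≠ m ∧ mate i ≠ mate m ∧
        m ≠ mate m) := by decide
  have key' : ∀ i : Fin 4, i ≠ shiftClass i ∧ i ≠ mate (shiftClass i) ∧ mate i ≠ shiftClass i ∧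
        mate i ≠ mate (shiftClass i) ∧ shiftClass i ≠ mate (shiftClass i) := by decide
  rcases key (cls x) m with rfl | rfl | ⟨h1, h2, h3, h4, h5⟩
  · obtain ⟨h1, h2, h3, h4, h5⟩ := key' (cls x)
    have := (h.areTwins_nb hx h1 h2 (by rwa [hc]) (by rwa [hc]) h5).1
    rwa [hc] at this
  · obtain ⟨h1, h2, h3, h4, h5⟩ := key' (cls x)
    have := (h.areTwins_nb hx h1 h2 (by rwa [hc]) (by rwa [hc]) h5).1
    rw [hc] at this
    rw [mate_mate]
    exact this.symm
  · exact (h.areTwins_nb hx h1 h2 (by rwa [hc]) (by rwa [hc]) h5).2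

/-- A vertex with a twin lies in a copy of some `C_{4r}[K̄₂]`. -/
theorem exists_cycle (h : IsSquareSystem cls nb) [Finite V] {x : V} (hx0 : cls x = 0)
    (hx : AreTwins cls nb x (twin cls nb x)) :
    ∃ (r : ℕ) (hr : 0 < r) (e : Fin (4 * r) × Fin 2 → V), Function.Injective e ∧
      (∀ a, cls (e a) = (Piece.cycle r hr 1).label a) ∧
      (∀ a b, (Piece.cycle r hr 1).graph.Adj a b → h.graph.Adj (e a) (e b)) ∧ x ∈ Set.range e := by
  -- Steps `α` stay in a class and steps `β` alternate between the classes 0 and 2, so the walk from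
  -- `x` has classes 0, 0, 2, 2, repeated. One such round is `F`, and its minimal period at `x` is
  -- the number `r`.
  let α : V → V := fun z => nb z (cls z)
  let β : V → V := fun z => nb z (shiftClass (cls z))
  let F : V → V := fun z => β (α (β (α z)))
  have hα : Function.Involutive α := by
    intro z
    simp only [α, h.cls_nb, h.nb_nb]
  have hβ : Function.Involutive β := by
    intro z
    simp only [β, h.cls_nb, shiftClass_shiftClass, h.nb_nb]
  have hα' : ∀ z, α z ≠ z := h.nb_ne
  have hinj : Function.Injective F :=
    hβ.injective.comp (hα.injective.comp (hβ.injective.comp hα.injective))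
  have hcα : ∀ z, cls (α z) = cls z := fun z => h.cls_nb _ _
  have hcβ : ∀ z, cls (β z) = shiftClass (cls z) := fun z => h.cls_nb _ _
  have hcF : ∀ t, cls (F^[t] x) = 0 := by
    intro t
    induction t with
    | zero => exact hx0
    | succ t ih =>
      rw [Function.iterate_succ_apply']
      simp only [F, hcα, hcβ, shiftClass_shiftClass, ih]
  have hne := iterate_ne_of_involutive hα hβ hα' x
  let r := Function.minimalPeriod F x
  have hr : 0 < r := Function.minimalPeriod_pos_of_mem_periodicPts
    (Function.Injective.mem_periodicPts hinj x)
  have hper : F^[r] x = x := Function.iterate_minimalPeriod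
  let D : V → Prop := fun z => AreTwins cls nb z (twin cls nb z)
  have hDα : ∀ z, D z → D (α z) := fun z hz => h.areTwins_twin_nb hz _
  have hDβ : ∀ z, D z → D (β z) := fun z hz => h.areTwins_twin_nb hz _
  have hDF : ∀ t, D (F^[t] x) := by
    intro t
    induction t with
    | zero => exact hx
    | succ t ih =>
      rw [Function.iterate_succ_apply']
      exact hDβ _ (hDα _ (hDβ _ (hDα _ ih)))
  let s : ℕ → V := fun p =>
    if p % 4 = 0 then F^[p / 4] x else if p % 4 = 1 then α (F^[p / 4] x)
    else if p % 4 = 2 then β (α (F^[p / 4] x)) else α (β (α (F^[p / 4] x)))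
  have hs : ∀ t, s (4 * t) = F^[t] x ∧ s (4 * t + 1) = α (F^[t] x) ∧
      s (4 * t + 2) = β (α (F^[t] x)) ∧ s (4 * t + 3) = α (β (α (F^[t] x))) := by
    intro t
    refine ⟨?_, ?_, ?_, ?_⟩
    · simp only [s, Nat.mul_mod_right, if_true, Nat.mul_div_cancel_left t (by norm_num : 0 < 4)]
    · simp only [s, Nat.mul_add_mod, Nat.mul_add_div (by norm_num : 0 < 4)]
      simp
    · simp only [s, Nat.mul_add_mod, Nat.mul_add_div (by norm_num : 0 < 4)]
      simp
    · simp only [s, Nat.mul_add_mod, Nat.mul_add_div (by norm_num : 0 < 4)]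
      simp
  have hp4 : ∀ p, ∃ t, p = 4 * t ∨ p = 4 * t + 1 ∨ p = 4 * t + 2 ∨ p = 4 * t + 3 :=
    fun p => ⟨p / 4, by omega⟩
  have hDs : ∀ p, D (s p) := by
    intro p
    obtain ⟨t, rfl | rfl | rfl | rfl⟩ := hp4 p
    · rw [(hs t).1]; exact hDF t
    · rw [(hs t).2.1]; exact hDα _ (hDF t)
    · rw [(hs t).2.2.1]; exact hDβ _ (hDα _ (hDF t))
    · rw [(hs t).2.2.2]; exact hDα _ (hDβ _ (hDα _ (hDF t)))
  have hcs : ∀ p, cls (s p) = if p % 4 < 2 then 0 else 2 := by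
    intro p
    obtain ⟨t, rfl | rfl | rfl | rfl⟩ := hp4 p
    · rw [(hs t).1, hcF, if_pos (by omega)]
    · rw [(hs t).2.1, hcα, hcF, if_pos (by omega)]
    · rw [(hs t).2.2.1, hcβ, hcα, hcF, if_neg (by omega)]; rfl
    · rw [(hs t).2.2.2, hcα, hcβ, hcα, hcF, if_neg (by omega)]; rfl
  have hαadj : ∀ z, h.graph.Adj z (α z) := fun z => by
    rw [h.graph_adj, hcα]
  have hβadj : ∀ z, h.graph.Adj z (β z) := fun z => by
    rw [h.graph_adj, hcβ]
  have hadj : ∀ p, h.graph.Adj (s p) (s (p + 1)) := by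
    intro p
    obtain ⟨t, rfl | rfl | rfl | rfl⟩ := hp4 p
    · rw [(hs t).1, (hs t).2.1]; exact hαadj _
    · rw [(hs t).2.1, (hs t).2.2.1]; exact hβadj _
    · rw [(hs t).2.2.1, (hs t).2.2.2]; exact hαadj _
    · rw [(hs t).2.2.2, show 4 * t + 3 + 1 = 4 * (t + 1) by ring, (hs (t + 1)).1,
        Function.iterate_succ_apply']
      exact hβadj _
  have hclose : h.graph.Adj (s (4 * r - 1)) (s 0) := by
    have := hadj (4 * r - 1)
    rw [show 4 * r - 1 + 1 = 4 * r by omega, (hs r).1, hper] at this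
    have h0 := (hs 0).1
    rw [Nat.mul_zero] at h0
    rwa [h0]
  have hinjF : ∀ t t', t < r → t' < r → F^[t] x = F^[t'] x → t = t' := fun t t' ht ht' hh =>
    Function.iterate_injOn_Iio_minimalPeriod ht ht' hh
  have hne' : ∀ t t', β (α (F^[t] x)) ≠ α (β (α (F^[t'] x))) := by
    intro t t' hh
    apply hne (t + 1) t'
    change F^[t + 1] x = α (F^[t'] x)
    rw [Function.iterate_succ_apply']
    change β (α (β (α (F^[t] x)))) = _
    rw [hh, hα, hβ]
  -- Positions in different halves of a round differ in class, an `α`-image is never on the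
  -- `F`-orbit by semiregularity, and equal residues modulo 4 are separated by the minimal period.
  have hsinj : ∀ p q, p < 4 * r → q < 4 * r → s p = s q → p = q := by
    intro p q hp hq hpq
    have hc := hcs p
    rw [hpq, hcs q] at hc
    have h02 : (0 : Fin 4) ≠ 2 := by decide
    obtain ⟨t, ht⟩ := hp4 p
    obtain ⟨t', ht'⟩ := hp4 q
    rcases ht with rfl | rfl | rfl | rfl <;> rcases ht' with rfl | rfl | rfl | rfl <;>
      simp only [hs] at hpq <;>
      first
      | (have := hinjF t t' (by omega) (by omega)
          (by first | exact hpq | exact hα.injective hpq | exact hα.injective (hβ.injective hpq) |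
                exact hα.injective (hβ.injective (hα.injective hpq)))
         omega)
      | exact (hne _ _ hpq).elim
      | exact (hne _ _ hpq.symm).elim
      | exact (hne' _ _ hpq).elim
      | exact (hne' _ _ hpq.symm).elim
      | (rw [if_pos (by omega), if_neg (by omega)] at hc; exact (h02 hc).elim)
      | (rw [if_neg (by omega), if_pos (by omega)] at hc; exact (h02 hc.symm).elim)
  have htcls : ∀ z, cls (twin cls nb z) = mate (cls z) := fun z => h.cls_nb _ _
  have htt : ∀ z, D z → twin cls nb (twin cls nb z) = z := by
    intro z hz
    rw [twin, htcls, mate_mate, ← hz.2, h.nb_nb]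
  have hadjtw : ∀ z w, D w → h.graph.Adj z w → h.graph.Adj z (twin cls nb w) := by
    intro z w hw hzw
    have h1 := h.graph_adj.1 hzw.symm
    rw [h.graph_adj, htcls]
    have h2 := h.twin_eq hw (cls z)
    rwa [← h1] at h2
  -- The second copy consists of the twins, which lie in the mated classes and have the same
  -- neighbours.
  let e : Fin (4 * r) × Fin 2 → V := fun a =>
    if a.2 = 0 then s a.1.val else twin cls nb (s a.1.val)
  have he0 : ∀ p, e (p, 0) = s p.val := fun p => rfl
  have he1 : ∀ p, e (p, 1) = twin cls nb (s p.val) := fun p => rfl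
  have hfin2 : ∀ b : Fin 2, b = 0 ∨ b = 1 := by decide
  have hecls : ∀ a, cls (e a) = (Piece.cycle r hr 1).label a := by
    rintro ⟨p, b⟩
    change cls (e (p, b)) = if p.val % 4 < 2 then (if b = 0 then 0 else 1) else (if b = 0 then 2 else 3)
    rcases hfin2 b with rfl | rfl
    · rw [he0, hcs]; rfl
    · rw [he1, htcls, hcs]
      split_ifs <;> first | rfl | (exfalso; omega)
  have headj : ∀ p q b c, h.graph.Adj (s p) (s q) → ∀ hp hq,
      h.graph.Adj (e (⟨p, hp⟩, b)) (e (⟨q, hq⟩, c)) := by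
    intro p q b c hpq hp hq
    have hpq' := hadjtw _ _ (hDs q) hpq
    rcases hfin2 b with rfl | rfl <;> rcases hfin2 c with rfl | rfl
    · exact hpq
    · exact hpq'
    · exact (hadjtw _ _ (hDs p) hpq.symm).symm
    · exact (hadjtw _ _ (hDs p) hpq'.symm).symm
  refine ⟨r, hr, e, ?_, hecls, ?_, ⟨(⟨0, by omega⟩, 0), ?_⟩⟩
  · rintro ⟨p, b⟩ ⟨q, c⟩ hpq
    have hc : (Piece.cycle r hr 1).label (p, b) = (Piece.cycle r hr 1).label (q, c) := by
      rw [← hecls, ← hecls, hpq]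
    have hc' : (if p.val % 4 < 2 then (if b = 0 then 0 else 1) else (if b = 0 then 2 else 3) : Fin 4) =
      if q.val % 4 < 2 then (if c = 0 then 0 else 1) else (if c = 0 then 2 else 3) := hc
    have hbc : b = c := by
      by_cases h1 : p.val % 4 < 2 <;> by_cases h2 : q.val % 4 < 2 <;>
        simp only [h1, h2, if_true, if_false] at hc' <;> clear hpq hc <;> revert b c <;> decide
    subst hbc
    have : s p.val = s q.val := by
      rcases hfin2 b with rfl | rfl
      · exact hpq
      · rw [← htt _ (hDs p.val), ← htt _ (hDs q.val)]
        exact congrArg _ hpq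
    exact Prod.ext (Fin.ext (hsinj _ _ p.2 q.2 this)) rfl
  · rintro ⟨⟨p, hp⟩, b⟩ ⟨⟨q, hq⟩, c⟩ (hpq | ⟨-, hpq⟩)
    · rw [cycleGraph_adj_iff_val (by omega)] at hpq
      rcases hpq with hh | hh | ⟨hh, hh'⟩ | ⟨hh, hh'⟩ <;> simp only at hh
      · subst hh
        exact headj _ _ b c (hadj p) hp hq
      · subst hh
        exact headj _ _ b c (hadj q).symm hp hq
      · simp only at hh'
        subst hh hh'
        exact headj _ _ b c hclose.symm hp hq
      · simp only at hh'
        subst hh hh'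
        exact headj _ _ b c hclose hp hq
    · exact hpq.elim
  · have h0 := (hs 0).1
    rw [Nat.mul_zero] at h0
    rw [he0]
    exact h0

end IsSquareSystem

/-! ### Components without twins. -/

/-- The parity of the arrangement `i, j, k, l` of the four classes. -/
def evenOrder (i j k l : Fin 4) : Bool :=
  !(decide (j < i) ^^ decide (k < i) ^^ decide (l < i) ^^ decide (k < j) ^^ decide (l < j) ^^
    decide (l < k))

/-- The parity of a vertex of the 4-cube. -/
def wordEven (w : Fin 4 → Bool) : Bool := !(w 0 ^^ w 1 ^^ w 2 ^^ w 3)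

/-- An admissible equitable partition of the 4-cube. -/
def cubeLabel (w : Fin 4 → Bool) : Fin 4 :=
  if w 1 = w 2 ∧ w 2 = w 3 then 0
  else if w 1 = w 0 ∧ w 3 ≠ w 0 then 1
  else if w 1 ≠ w 0 ∧ w 2 = w 0 then 2 else 3

theorem cubeLabel_flipBit_surj : ∀ (x : Fin 4 → Bool) (c : Fin 4),
    ∃ i, cubeLabel (flipBit x i) = c ∧ ∀ i', cubeLabel (flipBit x i') = c → i' = i := by
  decide

theorem cubeLabel_directions : ∀ (x y : Fin 4 → Bool) (i : Fin 4),
    cubeLabel x = cubeLabel (flipBit x i) → cubeLabel y = cubeLabel (flipBit y i) →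
    cubeLabel x = cubeLabel y := by
  decide

theorem isAdmissibleCubePartition_perm (π : Equiv.Perm (Fin 4)) :
    IsAdmissibleCubePartition (π ∘ cubeLabel) where
  equitable x c := by
    obtain ⟨i, hi, hi'⟩ := cubeLabel_flipBit_surj x (π.symm c)
    rw [Set.ncard_eq_one]
    refine ⟨flipBit x i, Set.ext fun y => ?_⟩
    simp only [Set.mem_ofPred_eq, Set.mem_singleton_iff, fourCube_adj_iff, Function.comp_apply,
      ← Equiv.eq_symm_apply]
    constructor
    · rintro ⟨⟨i', rfl⟩, hy⟩
      rw [hi' i' hy]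
    · rintro rfl
      exact ⟨⟨i, rfl⟩, hi⟩
  directions x y i hx hy := by
    simp only [Function.comp_apply, π.injective.eq_iff] at *
    exact cubeLabel_directions x y i hx hy

-- This makes the 4-cycles of the cube match the geometry: at a vertex oriented by its parity, the
-- two walks around a 4-cycle are among those that `WalksMeet` makes coincide.
set_option synthInstance.maxSize 1000 in
set_option synthInstance.maxHeartbeats 200000 in
theorem cubeLabel_square : ∀ (u : Fin 4 → Bool) (d d' : Fin 4), d ≠ d' →
    ∃ j k l, j = cubeLabel (flipBit (flipBit u d) d') ∧ cubeLabel u ≠ j ∧ cubeLabel u ≠ k ∧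
      cubeLabel u ≠ l ∧ j ≠ k ∧ j ≠ l ∧ k ≠ l ∧ evenOrder (cubeLabel u) j k l = wordEven u ∧
      ((cubeLabel (flipBit u d) = cubeLabel u ∧ cubeLabel (flipBit u d') = k) ∨
       (cubeLabel (flipBit u d) = k ∧ cubeLabel (flipBit u d') = cubeLabel u) ∨
       (cubeLabel (flipBit u d) = j ∧ cubeLabel (flipBit u d') = l) ∨
       (cubeLabel (flipBit u d) = l ∧ cubeLabel (flipBit u d') = j)) := by
  decide

set_option synthInstance.maxSize 1000 in
set_option synthInstance.maxHeartbeats 200000 in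
theorem evenOrder_rotations : ∀ i j k l j' k' l' : Fin 4, i ≠ j → i ≠ k → i ≠ l → j ≠ k → j ≠ l →
    k ≠ l → i ≠ j' → i ≠ k' → i ≠ l' → j' ≠ k' → j' ≠ l' → k' ≠ l' →
    evenOrder i j' k' l' = evenOrder i j k l →
    (j' = j ∧ k' = k ∧ l' = l) ∨ (j' = k ∧ k' = l ∧ l' = j) ∨ (j' = l ∧ k' = j ∧ l' = k) := by
  decide

set_option synthInstance.maxSize 1000 in
set_option synthInstance.maxHeartbeats 200000 in
theorem evenOrder_swap : ∀ i j k l : Fin 4, i ≠ j → i ≠ k → i ≠ l → j ≠ k → j ≠ l → k ≠ l →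
    evenOrder i j l k = !evenOrder i j k l ∧ evenOrder j i k l = !evenOrder i j k l ∧
    evenOrder j l i k = !evenOrder i j k l := by
  decide

theorem exists_evenOrder : ∀ (i m : Fin 4) (s : Bool), i ≠ m → ∃ k l, i ≠ k ∧ i ≠ l ∧ m ≠ k ∧
    m ≠ l ∧ k ≠ l ∧ evenOrder i m k l = s := by
  decide

theorem fin_four_ne_exists : ∀ i : Fin 4, ∃ m, i ≠ m := by
  decide

theorem fin_four_cover : ∀ i j k l a : Fin 4, i ≠ j → i ≠ k → i ≠ l → j ≠ k → j ≠ l → k ≠ l →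
    a = i ∨ a = j ∨ a = k ∨ a = l := by
  decide

/-- The orientation of the three classes different from that of `x` along which the walks of
length two from `x` meet. -/
def Oriented {V : Type*} (cls : V → Fin 4) (nb : V → Fin 4 → V) (x : V) (s : Bool) : Prop :=
  ∀ j k l, cls x ≠ j → cls x ≠ k → cls x ≠ l → j ≠ k → j ≠ l → k ≠ l →
    evenOrder (cls x) j k l = s → WalksMeet nb x (cls x) j k l

namespace IsSquareSystem

variable {V : Type*} {cls : V → Fin 4} {nb : V → Fin 4 → V}

section

variable {x : V} {i j k l : Fin 4}

/-- From `nb x i`, the walks into class `k` through `j` and through `l` both end at `nb x k`. The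
square condition pairs these with the remaining two walks, so all four end there and `nb x i`, `nb x
k` are twins. -/
theorem exists_twin_of_walksMeet (h : IsSquareSystem cls nb) (hi : cls x = i) (hij : i ≠ j)
    (hik : i ≠ k) (hil : i ≠ l) (hjk : j ≠ k) (hjl : j ≠ l) (hkl : k ≠ l)
    (h1 : WalksMeet nb x i j k l) (h2 : WalksMeet nb x i l k j) : ∃ y, AreTwins cls nb x y := by
  rw [← h.exists_areTwins_nb_iff i]
  have hw : cls (nb x i) = i := h.cls_nb x i
  have e1 : nb (nb (nb x i) j) k = nb x k := by
    rw [h1.1, h.nb_nb_of_cls (h.cls_nb x k)]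
  have e2 : nb (nb (nb x i) l) k = nb x k := by
    rw [h2.1, h.nb_nb_of_cls (h.cls_nb x k)]
  have hsq := h.square (nb x i) k j l (by rwa [hw]) (by rwa [hw]) (by rwa [hw]) hjk.symm hkl hjl
  rw [hw] at hsq
  have hboth : nb (nb (nb x i) i) k = nb x k ∧ nb (nb (nb x i) k) k = nb x k := by
    rcases hsq with ⟨a, b⟩ | ⟨a, b⟩
    · exact ⟨a.trans e1, b.trans e2⟩
    · exact ⟨a.trans e2, b.trans e1⟩
  refine ⟨nb x k, h.areTwins_of_common_end (j := k) (by rwa [hw]) fun a => ?_⟩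
  rcases fin_four_cover i j k l a hij hik hil hjk hjl hkl with rfl | rfl | rfl | rfl
  · exact hboth.1
  · exact e1
  · exact hboth.2
  · exact e2

theorem exists_twin_of_four (h : IsSquareSystem cls nb) (hi : cls x = i) (hij : i ≠ j)
    (hik : i ≠ k) (hil : i ≠ l) (hjk : j ≠ k) (hjl : j ≠ l) (hkl : k ≠ l)
    (h1 : WalksMeet nb x i j k l) (h2 : nb (nb x i) j = nb (nb x j) j) :
    ∃ y, AreTwins cls nb x y := by
  refine ⟨nb (nb x i) j, h.areTwins_of_common_end (j := j) (by rwa [hi]) fun a => ?_⟩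
  rcases fin_four_cover i j k l a hij hik hil hjk hjl hkl with rfl | rfl | rfl | rfl
  · rfl
  · exact h2.symm
  · exact h1.1.symm
  · rw [h2]
    exact h1.2.symm

/-- Of the two pairings possible towards class `l`, one would create a twin together with the given
pairing. -/
theorem walksMeet_rotate (h : IsSquareSystem cls nb) (hx : ¬ ∃ y, AreTwins cls nb x y)
    (hi : cls x = i) (hij : i ≠ j) (hik : i ≠ k) (hil : i ≠ l) (hjk : j ≠ k) (hjl : j ≠ l)
    (hkl : k ≠ l) (h1 : WalksMeet nb x i j k l) : WalksMeet nb x i l j k := by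
  subst hi
  rcases h.square x l k j hil hik hij hkl.symm hjl.symm hjk.symm with h2 | h2
  · exact (hx (h.exists_twin_of_walksMeet rfl hij hik hil hjk hjl hkl h1 h2)).elim
  · exact h2

theorem oriented_of_walksMeet (h : IsSquareSystem cls nb) (hx : ¬ ∃ y, AreTwins cls nb x y)
    (hi : cls x = i) (hij : i ≠ j) (hik : i ≠ k) (hil : i ≠ l) (hjk : j ≠ k) (hjl : j ≠ l)
    (hkl : k ≠ l) (h1 : WalksMeet nb x i j k l) : Oriented cls nb x (evenOrder i j k l) := by
  have h2 := h.walksMeet_rotate hx hi hij hik hil hjk hjl hkl h1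
  have h3 := h.walksMeet_rotate hx hi hil hij hik hjl.symm hkl.symm hjk h2
  intro j' k' l' a1 a2 a3 a4 a5 a6 hs
  rw [hi] at *
  rcases evenOrder_rotations i j k l j' k' l' hij hik hil hjk hjl hkl a1 a2 a3 a4 a5 a6 hs with
    ⟨rfl, rfl, rfl⟩ | ⟨rfl, rfl, rfl⟩ | ⟨rfl, rfl, rfl⟩
  · exact h1
  · exact h3
  · exact h2

end

theorem oriented_unique (h : IsSquareSystem cls nb) {x : V} (hx : ¬ ∃ y, AreTwins cls nb x y)
    {s t : Bool} (hs : Oriented cls nb x s) (ht : Oriented cls nb x t) : s = t := by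
  by_contra hst
  obtain ⟨m, hm⟩ := fin_four_ne_exists (cls x)
  obtain ⟨k, l, h1, h2, h3, h4, h5, h6⟩ := exists_evenOrder (cls x) m s hm
  have e1 := hs m k l hm h1 h2 h3 h4 h5 h6
  have e2 := ht m l k hm h2 h1 h4 h3 h5.symm (by
    rw [(evenOrder_swap _ m k l hm h1 h2 h3 h4 h5).1, h6]
    cases s <;> cases t <;> simp_all)
  exact hx (h.exists_twin_of_four rfl hm h1 h2 h3 h4 h5 e1 (e1.1.trans e2.2.symm))

/-- One pairing determines the orientation of `nb x m`. The wrong pairing, combined with one at `x`,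
would make all four walks from `x` or from `nb x m` into some class end together, hence give a twin.
-/
theorem oriented_nb (h : IsSquareSystem cls nb) {x : V} (hx : ¬ ∃ y, AreTwins cls nb x y)
    {s : Bool} (hs : Oriented cls nb x s) (m : Fin 4) : Oriented cls nb (nb x m) (!s) := by
  have hxm : ¬ ∃ y, AreTwins cls nb (nb x m) y := by rwa [h.exists_areTwins_nb_iff]
  by_cases hm : cls x = m
  · obtain ⟨j, hj⟩ := fin_four_ne_exists (cls x)
    obtain ⟨k, l, h1, h2, h3, h4, h5, rfl⟩ := exists_evenOrder (cls x) j s hj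
    have e1 := hs j k l hj h1 h2 h3 h4 h5 rfl
    have e2 := h.walksMeet_rotate hx rfl hj h1 h2 h3 h4 h5 e1
    have e3 := h.walksMeet_rotate hx rfl h2 hj h1 h4.symm h5.symm h3 e2
    rw [← (evenOrder_swap _ j k l hj h1 h2 h3 h4 h5).1]
    rw [← hm] at hxm ⊢
    have hc := h.cls_nb x (cls x)
    refine h.oriented_of_walksMeet hxm hc hj h2 h1 h4 h3 h5.symm ?_
    have hsq := h.square (nb x (cls x)) j k l (by rwa [hc]) (by rwa [hc]) (by rwa [hc]) h3 h4 h5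
    rw [hc] at hsq
    rcases hsq with ⟨a, -⟩ | h'
    · rw [h.nb_nb] at a
      refine (hx (h.exists_twin_of_four rfl h1 h2 hj h5 h3.symm h4.symm e3 ?_)).elim
      rw [e3.2, a, h.nb_nb_of_cls (h.cls_nb _ k)]
    · exact h'
  · obtain ⟨k, l, h1, h2, h3, h4, h5, rfl⟩ := exists_evenOrder (cls x) m s hm
    have e1 := hs m k l hm h1 h2 h3 h4 h5 rfl
    rw [← (evenOrder_swap _ m k l hm h1 h2 h3 h4 h5).2.2]
    have hc := h.cls_nb x m
    refine h.oriented_of_walksMeet hxm hc h4 (Ne.symm hm) h3 h2.symm h5.symm h1 ?_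
    have hsq := h.square (nb x m) l (cls x) k (by rwa [hc]) (by rw [hc]; exact Ne.symm hm)
      (by rwa [hc]) h2.symm h5.symm h1
    rw [hc] at hsq
    rcases hsq with h' | h'
    · exact h'
    · refine (hxm (h.exists_twin_of_four hc h4 h3 (Ne.symm hm) h5.symm h2.symm h1.symm h' ?_)).elim
      rw [h'.2, h.nb_nb, e1.2, h.nb_nb_of_cls (h.cls_nb x l)]

end IsSquareSystem

theorem flipBit_of_ne {x : Fin 4 → Bool} {i j : Fin 4} (h : j ≠ i) : flipBit x i j = x j := by
  simp [flipBit, h]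

theorem flipBit_self (x : Fin 4 → Bool) (i : Fin 4) : flipBit x i i = !x i := by
  simp [flipBit]

theorem flipBit_flipBit (x : Fin 4 → Bool) (i : Fin 4) : flipBit (flipBit x i) i = x := by
  funext j
  by_cases h : j = i
  · subst h; simp [flipBit]
  · simp [flipBit, h]

theorem wordEven_flipBit : ∀ (x : Fin 4 → Bool) (i : Fin 4), wordEven (flipBit x i) = !wordEven x := by
  decide

/-- The first `n` letters of a word, completed by zeros. -/
def wordPrefix (w : Fin 4 → Bool) (n : ℕ) : Fin 4 → Bool := fun i => w i && decide (i.val < n)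

theorem wordPrefix_four (w : Fin 4 → Bool) : wordPrefix w 4 = w := by
  funext i
  simp [wordPrefix]

theorem wordPrefix_succ_of_true {w : Fin 4 → Bool} {i : Fin 4} (h : w i = true) :
    wordPrefix w (i.val + 1) = flipBit (wordPrefix w i.val) i := by
  funext j
  by_cases hj : j = i
  · subst hj; simp [wordPrefix, flipBit, h]
  · have : j.val ≠ i.val := fun h' => hj (Fin.ext h')
    rw [flipBit_of_ne hj]
    have h2 : j.val < i.val + 1 ↔ j.val < i.val := by omega
    simp [wordPrefix, h2]

theorem wordPrefix_succ_of_false {w : Fin 4 → Bool} {i : Fin 4} (h : w i = false) :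
    wordPrefix w (i.val + 1) = wordPrefix w i.val := by
  funext j
  by_cases hj : j = i
  · subst hj; simp [wordPrefix, h]
  · have : j.val ≠ i.val := fun h' => hj (Fin.ext h')
    have h2 : j.val < i.val + 1 ↔ j.val < i.val := by omega
    simp [wordPrefix, h2]

theorem wordPrefix_flipBit_of_lt {w : Fin 4 → Bool} {i : Fin 4} {n : ℕ} (h : i.val < n) :
    wordPrefix (flipBit w i) n = flipBit (wordPrefix w n) i := by
  funext j
  by_cases hj : j = i
  · subst hj; simp [wordPrefix, flipBit, h]
  · rw [flipBit_of_ne hj]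
    simp [wordPrefix, flipBit_of_ne hj]

/-- The vertex reached from `x` by reading the first `n` letters of the word `w`. -/
def cubeWalk {V : Type*} (nb : V → Fin 4 → V) (x : V) (w : Fin 4 → Bool) : ℕ → V
  | 0 => x
  | n + 1 => if wordPrefix w (n + 1) = wordPrefix w n then cubeWalk nb x w n
      else nb (cubeWalk nb x w n) (cubeLabel (wordPrefix w (n + 1)))

section

variable {V : Type*} {nb : V → Fin 4 → V} {x : V}

theorem cubeWalk_succ_of_false {w : Fin 4 → Bool} {i : Fin 4} (h : w i = false) :
    cubeWalk nb x w (i.val + 1) = cubeWalk nb x w i.val := by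
  rw [cubeWalk, if_pos (wordPrefix_succ_of_false h)]

theorem cubeWalk_succ_of_true {w : Fin 4 → Bool} {i : Fin 4} (h : w i = true) :
    cubeWalk nb x w (i.val + 1) =
      nb (cubeWalk nb x w i.val) (cubeLabel (flipBit (wordPrefix w i.val) i)) := by
  rw [cubeWalk, wordPrefix_succ_of_true h, if_neg]
  intro h'
  have := congrFun h' i
  rw [flipBit_self] at this
  simp at this

theorem cubeWalk_flipBit_of_le (w : Fin 4 → Bool) (i : Fin 4) : ∀ n, n ≤ i.val →
    cubeWalk nb x (flipBit w i) n = cubeWalk nb x w n := by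
  have hp : ∀ n, n ≤ i.val → wordPrefix (flipBit w i) n = wordPrefix w n := by
    intro n hn
    funext j
    by_cases hj : j = i
    · subst hj
      have : ¬ j.val < n := by omega
      simp [wordPrefix, this]
    · simp [wordPrefix, flipBit_of_ne hj]
  intro n
  induction n with
  | zero => intro _; rfl
  | succ n ih =>
    intro hn
    rw [cubeWalk, cubeWalk, hp _ hn, hp _ (by omega), ih (by omega)]

end

theorem cubeLabel_eq_cases : ∀ v w : Fin 4 → Bool, cubeLabel v = cubeLabel w →
    wordEven v = wordEven w → v = w ∨ w = fun i => !v i := by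
  decide

/-- A word at distance two from `v` and from its antipode has each of its neighbours adjacent to one
of them. If the two had the same image, that image would acquire a twin. -/
theorem cubeLabel_antipode_cover : ∀ (v : Fin 4 → Bool) (c : Fin 4), ∃ d d',
    cubeLabel (flipBit (flipBit (flipBit v 0) 1) d) = c ∧
      (flipBit (flipBit (flipBit v 0) 1) d = flipBit v d' ∨
        flipBit (flipBit (flipBit v 0) 1) d = flipBit (fun i => !v i) d') := by
  decide

theorem cubeLabel_flipBit_flipBit_ne : ∀ v : Fin 4 → Bool,
    cubeLabel v ≠ cubeLabel (flipBit (flipBit v 0) 1) := by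
  decide

namespace IsSquareSystem

variable {V : Type*} {cls : V → Fin 4} {nb : V → Fin 4 → V}

/-- A vertex without twins lies in a copy of the 4-cube. -/
theorem exists_cube (h : IsSquareSystem cls nb) {x : V} (hx0 : cls x = 0)
    (hx : ¬ ∃ y, AreTwins cls nb x y) (hor : Oriented cls nb x true) :
    ∃ e : (Fin 4 → Bool) → V, Function.Injective e ∧ (∀ a, cls (e a) = cubeLabel a) ∧
      (∀ a b, fourCube.Adj a b → h.graph.Adj (e a) (e b)) ∧ x ∈ Set.range e := by
  have hat : ∀ w n, n ≤ 4 → cls (cubeWalk nb x w n) = cubeLabel (wordPrefix w n) ∧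
      (¬ ∃ y, AreTwins cls nb (cubeWalk nb x w n) y) ∧
      Oriented cls nb (cubeWalk nb x w n) (wordEven (wordPrefix w n)) := by
    intro w n
    induction n with
    | zero =>
      intro _
      have : wordPrefix w 0 = fun _ => false := by
        funext i; simp [wordPrefix]
      rw [this]
      exact ⟨hx0, hx, hor⟩
    | succ n ih =>
      intro hn
      obtain ⟨h1, h2, h3⟩ := ih (by omega)
      obtain ⟨i, rfl⟩ : ∃ i : Fin 4, n = i.val := ⟨⟨n, by omega⟩, rfl⟩
      by_cases hw : w i = true
      · rw [cubeWalk_succ_of_true (i := i) hw, wordPrefix_succ_of_true (i := i) hw, wordEven_flipBit]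
        exact ⟨h.cls_nb _ _, by rwa [h.exists_areTwins_nb_iff], h.oriented_nb h2 h3 _⟩
      · rw [cubeWalk_succ_of_false (i := i) (by simpa using hw),
          wordPrefix_succ_of_false (i := i) (by simpa using hw)]
        exact ⟨h1, h2, h3⟩
  have hsq : ∀ (u : Fin 4 → Bool) z, cls z = cubeLabel u → Oriented cls nb z (wordEven u) →
      ∀ d d', d ≠ d' →
        nb (nb z (cubeLabel (flipBit u d))) (cubeLabel (flipBit (flipBit u d) d')) =
        nb (nb z (cubeLabel (flipBit u d'))) (cubeLabel (flipBit (flipBit u d) d')) := by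
    intro u z hz ho d d' hd
    obtain ⟨j, k, l, hj, h1, h2, h3, h4, h5, h6, h7, h8⟩ := cubeLabel_square u d d' hd
    rw [← hz] at h1 h2 h3 h7 h8
    have hm := ho j k l h1 h2 h3 h4 h5 h6 h7
    rw [← hj]
    rcases h8 with ⟨a, b⟩ | ⟨a, b⟩ | ⟨a, b⟩ | ⟨a, b⟩ <;> rw [a, b]
    · exact hm.1
    · exact hm.1.symm
    · exact hm.2
    · exact hm.2.symm
  -- A changed letter `d` is carried past the later letters, one commuting 4-cycle at a time; hence
  -- edges in every direction go to edges.
  have hedge : ∀ n, n ≤ 4 → ∀ (d : Fin 4), d.val < n → ∀ w, w d = false →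
      cubeWalk nb x (flipBit w d) n =
        nb (cubeWalk nb x w n) (cubeLabel (flipBit (wordPrefix w n) d)) := by
    intro n
    induction n with
    | zero => intro _ d hd; omega
    | succ n ih =>
      intro hn d hd w hw
      obtain ⟨i, rfl⟩ : ∃ i : Fin 4, n = i.val := ⟨⟨n, by omega⟩, rfl⟩
      by_cases hdi : d = i
      · obtain rfl : i = d := hdi.symm
        have e1 : flipBit w i i = true := by rw [flipBit_self, hw]; rfl
        have e2 : cubeWalk nb x (flipBit w i) (i.val + 1) = _ := cubeWalk_succ_of_true e1
        have e3 : cubeWalk nb x w (i.val + 1) = _ := cubeWalk_succ_of_false hw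
        have e4 : wordPrefix w (i.val + 1) = _ := wordPrefix_succ_of_false hw
        have e5 : wordPrefix (flipBit w i) (i.val + 1) = _ := wordPrefix_succ_of_true e1
        change cubeWalk nb x (flipBit w i) (i.val + 1) = _
        rw [e2, ← e5, wordPrefix_flipBit_of_lt (by omega), cubeWalk_flipBit_of_le _ _ _ le_rfl]
        rw [e3]
      · have hdn : d.val < i.val := by
          have : d.val ≠ i.val := fun h' => hdi (Fin.ext h')
          omega
        have ih' := ih (by omega) d hdn w hw
        obtain ⟨h1, h2, h3⟩ := hat w i.val (by omega)
        have hfi : flipBit w d i = w i := flipBit_of_ne (Ne.symm hdi)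
        change cubeWalk nb x (flipBit w d) (i.val + 1) =
          nb (cubeWalk nb x w (i.val + 1)) (cubeLabel (flipBit (wordPrefix w (i.val + 1)) d))
        by_cases hwi : w i = true
        · rw [cubeWalk_succ_of_true (hfi.trans hwi), cubeWalk_succ_of_true hwi,
            wordPrefix_succ_of_true hwi, wordPrefix_flipBit_of_lt hdn]
          rw [ih']
          have hcomm : flipBit (flipBit (wordPrefix w i.val) d) i =
              flipBit (flipBit (wordPrefix w i.val) i) d := by
            unfold flipBit
            rw [Function.update_of_ne (Ne.symm hdi), Function.update_of_ne hdi,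
              Function.update_comm hdi]
          rw [← hcomm]
          exact hsq _ _ h1 h3 d i hdi
        · have hwi' : w i = false := by simpa using hwi
          rw [cubeWalk_succ_of_false (hfi.trans hwi'), cubeWalk_succ_of_false hwi',
            wordPrefix_succ_of_false hwi']
          exact ih'
  let e : (Fin 4 → Bool) → V := fun w => cubeWalk nb x w 4
  have he : ∀ w, cls (e w) = cubeLabel w ∧ (¬ ∃ y, AreTwins cls nb (e w) y) ∧
      Oriented cls nb (e w) (wordEven w) := by
    intro w
    have := hat w 4 le_rfl
    rwa [wordPrefix_four] at this
  have hnb : ∀ w d, e (flipBit w d) = nb (e w) (cubeLabel (flipBit w d)) := by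
    intro w d
    by_cases hw : w d = false
    · have := hedge 4 le_rfl d d.2 w hw
      rwa [wordPrefix_four] at this
    · have := hedge 4 le_rfl d d.2 (flipBit w d) (by rw [flipBit_self]; simpa using hw)
      rw [wordPrefix_four, flipBit_flipBit] at this
      change e w = nb (e (flipBit w d)) _ at this
      rw [this, ← (he (flipBit w d)).1, h.nb_nb]
  refine ⟨e, ?_, fun a => (he a).1, ?_, ⟨fun _ => false, ?_⟩⟩
  · intro v w hvw
    have hlab : cubeLabel v = cubeLabel w := by rw [← (he v).1, hvw, (he w).1]
    -- The orientation of the common image recovers the parity of the word, so label and parity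
    -- leave only antipodes to separate.
    have hpar : wordEven v = wordEven w :=
      oriented_unique h (he v).2.1 (he v).2.2 (by rw [hvw]; exact (he w).2.2)
    rcases cubeLabel_eq_cases v w hlab hpar with rfl | rfl
    · rfl
    · exfalso
      refine (he v).2.1 ⟨e (flipBit (flipBit v 0) 1), ?_, fun c => ?_⟩
      · rw [(he _).1, (he _).1]
        exact cubeLabel_flipBit_flipBit_ne v
      · obtain ⟨d, d', hc, hd⟩ := cubeLabel_antipode_cover v c
        have h1 := hnb (flipBit (flipBit v 0) 1) d
        rw [hc] at h1
        rw [← h1]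
        rcases hd with hd | hd
        · rw [hd, hnb, ← hd, hc]
        · rw [hd, hnb, ← hd, hc, hvw]
  · intro a b hab
    obtain ⟨i, rfl⟩ := (fourCube_adj_iff a b).1 hab
    rw [h.graph_adj, (he _).1]
    exact hnb a i
  · have : ∀ n, wordPrefix (fun _ => false) n = fun _ => false := by
      intro n; funext i; simp [wordPrefix]
    simp [e, cubeWalk, this]

end IsSquareSystem

/-! ### Assembling the components. -/

theorem exists_perm_zero_one : ∀ i j : Fin 4, i ≠ j → ∃ π : Equiv.Perm (Fin 4), π 0 = i ∧ π 1 = j := by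
  decide

theorem Piece.label_cycle (r : ℕ) (hr : 0 < r) (τ : Equiv.Perm (Fin 4)) (a : Fin (4 * r) × Fin 2) :
    (Piece.cycle r hr τ).label a = τ ((Piece.cycle r hr 1).label a) := by
  simp only [Piece.label, apply_ite τ, Equiv.Perm.one_apply]

namespace IsSquareSystem

variable {V : Type*} {cls : V → Fin 4} {nb : V → Fin 4 → V}

theorem perm_graph_adj (h : IsSquareSystem cls nb) (π : Equiv.Perm (Fin 4)) (x y : V) :
    (h.perm π).graph.Adj x y ↔ h.graph.Adj x y := by
  rw [graph_adj, graph_adj]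
  simp

theorem exists_piece [Finite V] (h : IsSquareSystem cls nb) (x : V) :
    ∃ (P : Piece) (e : P.Vertex → V), Function.Injective e ∧ (∀ a, cls (e a) = P.label a) ∧
      (∀ a b, P.graph.Adj a b → h.graph.Adj (e a) (e b)) ∧ x ∈ Set.range e := by
  by_cases hx : ∃ y, AreTwins cls nb x y
  · obtain ⟨y, hy⟩ := hx
    obtain ⟨π, hπ0, hπ1⟩ := exists_perm_zero_one _ _ hy.1
    have hx0 : (π.symm ∘ cls) x = 0 := by simp [← hπ0]
    have hy1 : (π.symm ∘ cls) y = 1 := by simp [← hπ1]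
    obtain ⟨r, hr, e, he1, he2, he3, he4⟩ := (h.perm π).exists_cycle hx0
      ((areTwins_twin_iff (h.perm π)).2 ⟨y, by rw [hx0, hy1]; rfl,
        by rw [hx0, hy1]; decide, fun a => hy.2 _⟩)
    have hlab : ∀ a : Fin (4 * r) × Fin 2, cls (e a) = (Piece.cycle r hr π).label a := by
      intro a
      rw [Piece.label_cycle, ← he2]
      simp
    exact ⟨Piece.cycle r hr π, e, he1, hlab, fun a b hab => (h.perm_graph_adj π _ _).1 (he3 a b hab),
      he4⟩
  · obtain ⟨π, hπ0, hπ⟩ : ∃ π : Equiv.Perm (Fin 4), π 0 = cls x ∧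
        WalksMeet (fun x j => nb x (π j)) x 0 1 2 3 := by
      let π : Equiv.Perm (Fin 4) := Equiv.swap 0 (cls x)
      have hπ : π 0 = cls x := Equiv.swap_apply_left _ _
      have hx0 : (π.symm ∘ cls) x = 0 := by simp [← hπ]
      have hsq := (h.perm π).square x 1 2 3
      rw [hx0] at hsq
      rcases hsq (by decide) (by decide) (by decide) (by decide) (by decide) (by decide) with h1 | h1
      · exact ⟨π, hπ, h1⟩
      -- Exchanging two of the other classes reverses the orientation at `x`.
      · exact ⟨(Equiv.swap 2 3).trans π, hπ, h1⟩
    have hx0 : (π.symm ∘ cls) x = 0 := by simp [← hπ0]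
    have hx' : ¬ ∃ y, AreTwins (π.symm ∘ cls) (fun x j => nb x (π j)) x y := by
      rintro ⟨y, hy1, hy2⟩
      refine hx ⟨y, fun h' => hy1 (congrArg π.symm h'), fun a => ?_⟩
      have := hy2 (π.symm a)
      simpa using this
    have hor := (h.perm π).oriented_of_walksMeet hx' hx0 (by decide) (by decide) (by decide)
      (by decide) (by decide) (by decide) hπ
    obtain ⟨e, he1, he2, he3, he4⟩ := (h.perm π).exists_cube hx0 hx' hor
    have hlab : ∀ a : Fin 4 → Bool, cls (e a) = π (cubeLabel a) := by
      intro a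
      rw [← he2]
      simp
    exact ⟨Piece.cube (π ∘ cubeLabel) (isAdmissibleCubePartition_perm π), e, he1, hlab,
      fun a b hab => (h.perm_graph_adj π _ _).1 (he3 a b hab), he4⟩

/-- Every square system is a disjoint union of building blocks. -/
theorem exists_equiv_sigma [Finite V] (h : IsSquareSystem cls nb) :
    ∃ (N : ℕ) (P : Fin N → Piece) (Φ : (Σ i, (P i).Vertex) ≃ V),
      (∀ w, cls (Φ w) = (P w.1).label w.2) ∧
      ∀ w w', h.graph.Adj (Φ w) (Φ w') ↔ (disjointUnion fun i => (P i).graph).Adj w w' := by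
  have : Finite h.graph.ConnectedComponent := Quot.finite _
  let c := Finite.equivFin h.graph.ConnectedComponent
  have hrep : ∀ C : h.graph.ConnectedComponent, ∃ x, h.graph.connectedComponentMk x = C :=
    fun C => Quot.exists_rep C
  choose rep hrep using hrep
  choose P e he1 he2 he3 he4 using fun i => h.exists_piece (rep (c.symm i))
  have hr := fun i => h.adj_iff_and_range (P i) (e i) (he1 i) (he2 i) (he3 i)
  have hcomp : ∀ i y, h.graph.connectedComponentMk y = c.symm i ↔ y ∈ Set.range (e i) := by
    intro i y
    obtain ⟨a, ha⟩ := he4 i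
    rw [← (hr i).2 a, ha, ← hrep (c.symm i), SimpleGraph.ConnectedComponent.eq, hrep]
    exact ⟨fun h' => h'.symm, fun h' => h'.symm⟩
  have hidx : ∀ i a j b, h.graph.Reachable (e i a) (e j b) → i = j := by
    intro i a j b hab
    have h1 := (hcomp i (e i a)).2 ⟨a, rfl⟩
    have h2 := (hcomp j (e j b)).2 ⟨b, rfl⟩
    rw [SimpleGraph.ConnectedComponent.eq.2 hab, h2] at h1
    exact (c.symm.injective h1).symm
  let Φ : (Σ i, (P i).Vertex) → V := fun w => e w.1 w.2
  have hΦ : Function.Bijective Φ := by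
    constructor
    · rintro ⟨i, a⟩ ⟨j, b⟩ hab
      have hab' : e i a = e j b := hab
      obtain rfl := hidx i a j b (by rw [hab'])
      rw [he1 i hab']
    · intro y
      obtain ⟨a, ha⟩ := (hcomp (c (h.graph.connectedComponentMk y)) y).1 (by simp)
      exact ⟨⟨_, a⟩, ha⟩
  refine ⟨_, P, Equiv.ofBijective Φ hΦ, fun w => he2 _ _, ?_⟩
  rintro ⟨i, a⟩ ⟨j, b⟩
  change h.graph.Adj (e i a) (e j b) ↔ _
  constructor
  · intro hab
    obtain rfl := hidx i a j b hab.reachable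
    exact ⟨i, a, b, rfl, rfl, ((hr i).1 a b).1 hab⟩
  · rintro ⟨k, a', b', h1, h2, hab⟩
    obtain ⟨rfl, h1⟩ := Sigma.mk.inj h1
    obtain ⟨rfl, h2⟩ := Sigma.mk.inj h2
    obtain rfl := eq_of_heq h1
    obtain rfl := eq_of_heq h2
    exact he3 _ _ _ hab

end IsSquareSystem

/-- Adjacency in `G` is adjacency in the graph of the square system, negated exactly between mated
classes, which is what `switchPairs` does. -/
theorem IsSpecialSystem.exists_iso_reverseSwitching {V : Type*} [Finite V] {G : SimpleGraph V}
    {cls : V → Fin 4} {nb : V → Fin 4 → V} (h : IsSpecialSystem G cls mate nb) :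
    ∃ (N : ℕ) (P : Fin N → Piece), Nonempty (G ≃g reverseSwitching P) := by
  obtain ⟨N, P, Φ, hcls, hadj⟩ := h.isSquareSystem.exists_equiv_sigma
  have hiso : reverseSwitching P ≃g G := ⟨Φ, by
    intro w w'
    rw [h.adj_iff, hcls, hcls]
    change _ ↔ (_ ∧ ¬ (disjointUnion fun i => (P i).graph).Adj w w') ∨
      (_ ∧ (disjointUnion fun i => (P i).graph).Adj w w')
    rw [← hadj, h.isSquareSystem.graph_adj, hcls]
    tauto⟩
  exact ⟨N, P, ⟨hiso.symm⟩⟩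

/-! ### The three matrices as conjugacy types of involutions, and the conclusion. -/

theorem matrix1_eq (n : ℕ) : matrix1 n = fun i j => if id i = j then n - 1 else 1 := by
  funext i j
  fin_cases i <;> fin_cases j <;> rfl

theorem matrix2_eq (n : ℕ) : matrix2 n = fun i j => if Equiv.swap 0 1 i = j then n - 1 else 1 := by
  funext i j
  fin_cases i <;> fin_cases j <;> rfl

theorem matrix3_eq (n : ℕ) : matrix3 n = fun i j => if mate i = j then n - 1 else 1 := by
  funext i j
  fin_cases i <;> fin_cases j <;> rfl

/-- The cycle type of an involution of four points is determined by its zero, one or two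
transpositions. -/
theorem involution_conj_aux : ∀ a b c d : Fin 4,
    (∀ i, ![a, b, c, d] (![a, b, c, d] i) = i) → ∃ π : Equiv.Perm (Fin 4),
      (∀ i, ![a, b, c, d] i = π.symm (π i)) ∨
      (∀ i, ![a, b, c, d] i = π.symm (Equiv.swap 0 1 (π i))) ∨
      (∀ i, ![a, b, c, d] i = π.symm (mate (π i))) := by
  decide

theorem involution_conj (σ : Fin 4 → Fin 4) (hσ : ∀ i, σ (σ i) = i) : ∃ π : Equiv.Perm (Fin 4),
    (∀ i, σ i = π.symm (id (π i))) ∨ (∀ i, σ i = π.symm (Equiv.swap 0 1 (π i))) ∨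
      (∀ i, σ i = π.symm (mate (π i))) := by
  have h : σ = ![σ 0, σ 1, σ 2, σ 3] := by
    funext i; fin_cases i <;> rfl
  rw [h] at hσ ⊢
  exact involution_conj_aux _ _ _ _ hσ

end LatticeDDG


theorem mainTheorem1 {V : Type*} [Finite V] (G : SimpleGraph V) (n : ℕ) (hn : 2 ≤ n) (hn4 : n ≠ 4)
    (cls : V → Fin 4) (hG : LatticeDDG.IsDDG G (4 * n) (n + 2) (n - 2) 2 4 n cls) :
    (Odd n → Nonempty (G ≃g LatticeDDG.latticeGraph 4 n)) ∧
    (Even n →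
      (∃ π : Equiv.Perm (Fin 4),
        LatticeDDG.IsQuotientMatrix G (π ∘ cls) (LatticeDDG.matrix1 n) ∨
        LatticeDDG.IsQuotientMatrix G (π ∘ cls) (LatticeDDG.matrix2 n) ∨
        LatticeDDG.IsQuotientMatrix G (π ∘ cls) (LatticeDDG.matrix3 n)) ∧
      ∀ π : Equiv.Perm (Fin 4),
        (LatticeDDG.IsQuotientMatrix G (π ∘ cls) (LatticeDDG.matrix1 n) →
          Nonempty (G ≃g LatticeDDG.latticeGraph 4 n)) ∧
        (LatticeDDG.IsQuotientMatrix G (π ∘ cls) (LatticeDDG.matrix2 n) →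
          Nonempty (G ≃g LatticeDDG.gPrime n)) ∧
        (LatticeDDG.IsQuotientMatrix G (π ∘ cls) (LatticeDDG.matrix3 n) →
          ∃ (N : ℕ) (P : Fin N → LatticeDDG.Piece),
            Nonempty (G ≃g LatticeDDG.reverseSwitching P))) := by
  have hlattice : ∀ cls' : V → Fin 4, LatticeDDG.IsDDG G (4 * n) (n + 2) (n - 2) 2 4 n cls' →
      LatticeDDG.IsQuotientMatrix G cls' (fun i j => if id i = j then n - 1 else 1) →
      Nonempty (G ≃g LatticeDDG.latticeGraph 4 n) := by
    intro cls' hG' hQ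
    obtain ⟨nb, hnb⟩ := hG'.exists_isSpecialSystem hn (fun _ => rfl) hQ
    have hcard : Nat.card {x // cls' x = 0} = n := by
      rw [← hG'.card_class 0, ← Nat.card_coe_set_eq]
      rfl
    obtain ⟨f⟩ := hnb.nonempty_iso_gridGraph (Finite.equivFinOfCardEq hcard)
    obtain ⟨g⟩ := LatticeDDG.nonempty_gridGraph_iso 4 n
    exact ⟨f.trans g⟩
  obtain ⟨σ, hσ, hodd, hQ⟩ := hG.exists_involution hn hn4
  refine ⟨fun ho => ?_, fun he => ⟨?_, fun π => ⟨fun h1 => ?_, fun h2 => ?_, fun h3 => ?_⟩⟩⟩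
  · refine hlattice cls hG ?_
    simpa only [hodd ho, id] using hQ
  · obtain ⟨π, hπ⟩ := LatticeDDG.involution_conj σ hσ
    have hQπ := hQ.perm π
    have key : ∀ ρ : Fin 4 → Fin 4, (∀ i, σ i = π.symm (ρ (π i))) →
        LatticeDDG.IsQuotientMatrix G (π ∘ cls) (fun i j => if ρ i = j then n - 1 else 1) := by
      intro ρ hρ
      simpa only [hρ, Equiv.apply_symm_apply, π.symm.injective.eq_iff] using hQπ
    refine ⟨π, ?_⟩
    rw [LatticeDDG.matrix1_eq, LatticeDDG.matrix2_eq, LatticeDDG.matrix3_eq]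
    exact hπ.imp (key _) (Or.imp (key _) (key _))
  · rw [LatticeDDG.matrix1_eq] at h1
    exact hlattice _ (hG.perm π) h1
  · rw [LatticeDDG.matrix2_eq] at h2
    obtain ⟨nb, hnb⟩ := (hG.perm π).exists_isSpecialSystem hn (Equiv.swap_apply_self 0 1 · ) h2
    exact hnb.nonempty_iso_gPrime he ((hG.perm π).card_class 2)
  · rw [LatticeDDG.matrix3_eq] at h3
    obtain ⟨nb, hnb⟩ := (hG.perm π).exists_isSpecialSystem hn LatticeDDG.mate_mate h3
    exact hnb.exists_iso_reverseSwitching
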